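/- For a finite group $G$, the depth $\lambda(G)$ is the minimal length $t$ of a chain of subgroups $G=G_0>G_1>\cdots>G_t=1$ in which each $G_i$ is a maximal subgroup of $G_{i-1}$. Write $\mathrm{L}_2(q)=\mathrm{PSL}_2(\mathbb{F}_q)$, and let $\Omega(k)$ be the number of prime divisors of the positive integer $k$, counted with multiplicity. Theorem 3. For every $n\in\mathbb{N}$ there is a prime power $q$ such that $\lambda(\mathrm{L}_2(q))>n$. Moreover, one can take $q=2^k$ with $k$ a product of $n$ distinct odd primes: if $p_1,\dots,p_n$ are pairwise distinct odd primes and $k=p_1\cdots p_n$, then $\lambda(\mathrm{L}_2(2^k))\ge\Omega(k)+2$, and so $\lambda(\mathrm{L}_2(2^k))>n$. -/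

import Mathlib

universe u

/-- `H 0 > H 1 > ⋯ > H t` is an unrefinable chain of length `t` of the group `G`: it starts at `G`,
ends at the trivial subgroup, and each `H (i + 1)` is a maximal subgroup of `H i`, that is,
`H (i + 1) < H i` with no subgroup strictly in between (the values `H i` with `t < i` play
no role). -/
def IsUnrefinableChain {G : Type u} [Group G] (t : ℕ) (H : ℕ → Subgroup G) : Prop :=
  H 0 = ⊤ ∧ H t = ⊥ ∧ ∀ i < t, H (i + 1) ⋖ H i

/-- The depth of a finite group `G`: the minimal length of an unrefinable chain of `G`. -/
noncomputable def groupDepth (G : Type u) [Group G] : ℕ :=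
  sInf {t : ℕ | ∃ H : ℕ → Subgroup G, IsUnrefinableChain t H}

/-- Every finite group has an unrefinable chain, so the minimum in `groupDepth` is attained. -/
theorem exists_isUnrefinableChain_groupDepth (G : Type u) [Group G] [Finite G] :
    ∃ H : ℕ → Subgroup G, IsUnrefinableChain (groupDepth G) H := by
  have key : ∀ K : Subgroup G, ∃ (t : ℕ) (H : ℕ → Subgroup G),
      H 0 = K ∧ H t = ⊥ ∧ ∀ i < t, H (i + 1) ⋖ H i := by
    intro K
    induction K using WellFoundedLT.induction with
    | ind K ih =>
      by_cases hK : K = ⊥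
      · exact ⟨0, fun _ => K, rfl, hK, fun i hi => absurd hi (Nat.not_lt_zero i)⟩
      · obtain ⟨M, -, hM⟩ := exists_le_covBy_of_lt (bot_lt_iff_ne_bot.mpr hK)
        obtain ⟨t, H, h0, ht, hs⟩ := ih M hM.lt
        refine ⟨t + 1, fun i => Nat.casesOn i K H, rfl, ht, ?_⟩
        rintro (_ | i) hi
        · simpa [h0] using hM
        · exact hs i (Nat.lt_of_succ_lt_succ hi)
  obtain ⟨t, H, hH⟩ := key ⊤
  exact Nat.sInf_mem (s := {t : ℕ | ∃ H : ℕ → Subgroup G, IsUnrefinableChain t H}) ⟨t, H, hH⟩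

/-! For odd `k`, every unrefinable chain of `SL(2, F)` with `|F| = 2 ^ k` has length at least `Ω(k)
+ 2`. As the center is trivial in characteristic two, this bounds the depth of the projective group.

The proof is by strong induction on `k`. With `q = 2 ^ k`, it suffices that chains from a maximal
subgroup `M` have length at least `Ω(k) + 1`. By `subgroup_classification`, `M` is, up to conjugacy,
one of three kinds. For the Borel subgroup, the image in `Fˣ` costs `Ω(q - 1) ≥ Ω(k)` steps and the
unipotent kernel costs one more. For a dihedral normalizer of a torus, chains are at least as long
as `Ω` of its order, which is a multiple of `q + 1` or a proper multiple of `q - 1`; here `Ω(q + 1)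
≥ Ω(k) + 1`. For `SL(2, E)` with `E` a subfield of prime index, induction applies and exactly one
prime of `k` is lost.

The classification is elementary. A subgroup without involutions is abelian, by Burnside transfer.
Otherwise an involution of `H` with smallest centralizer in `H` is moved to `upper 1`, and the
involutions are counted by their fixed points and by their images of `∞` on the projective line
(`exists_involutions_of_fixed_point`). The count supplies enough involutions to show that `H` is of
dihedral type or that its translations form a subfield over which `H` is defined. -/

/-! ### Prime factors of `2 ^ k ± 1`. -/

section Arithmetic

open ArithmeticFunction

theorem cardFactors_add_one_le_of_dvd_of_lt {a b : ℕ} (hab : a ∣ b) (hlt : a < b) (ha : a ≠ 0) :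
    cardFactors a + 1 ≤ cardFactors b := by
  obtain ⟨c, rfl⟩ := hab
  have hc : 1 < c := by
    by_contra h
    have : a * c ≤ a * 1 := Nat.mul_le_mul_left a (by omega)
    omega
  rw [cardFactors_mul ha (by omega)]
  have := cardFactors_pos_iff_one_lt.mpr hc
  omega

theorem cardFactors_le_of_dvd {a b : ℕ} (hab : a ∣ b) (hb : b ≠ 0) :
    cardFactors a ≤ cardFactors b := by
  obtain ⟨c, rfl⟩ := hab
  rw [cardFactors_mul (left_ne_zero_of_mul hb) (right_ne_zero_of_mul hb)]
  omega

theorem cardFactors_prime_mul {p a : ℕ} (hp : p.Prime) (ha : a ≠ 0) :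
    cardFactors (p * a) = cardFactors a + 1 := by
  rw [cardFactors_mul hp.ne_zero ha, cardFactors_eq_one_iff_prime.mpr hp, add_comm]

/-- Each prime `p` multiplied into `a` makes `2 ^ a - 1` a proper divisor of `2 ^ (p * a) - 1`,
which gains at least one prime factor. -/
theorem cardFactors_le_cardFactors_two_pow_sub_one {k : ℕ} (hk : k ≠ 0) :
    cardFactors k ≤ cardFactors (2 ^ k - 1) := by
  induction k using induction_on_primes with
  | zero => simp at hk
  | one => simp
  | prime_mul p a hp ih =>
    have ha : a ≠ 0 := right_ne_zero_of_mul hk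
    have h2 : 2 ^ a < 2 ^ (p * a) := by
      have := Nat.mul_le_mul_right a hp.two_le
      exact Nat.pow_lt_pow_right (by norm_num) (by omega)
    have h3 : 2 ^ 1 ≤ 2 ^ a := Nat.pow_le_pow_right (by norm_num) (by omega)
    have hdvd : 2 ^ a - 1 ∣ 2 ^ (p * a) - 1 := by
      simpa [← pow_mul, mul_comm] using Nat.sub_dvd_pow_sub_pow (2 ^ a) 1 p
    have := cardFactors_add_one_le_of_dvd_of_lt hdvd (by omega) (by omega)
    rw [cardFactors_prime_mul hp ha]
    have := ih ha
    omega

/-- The same induction, where the divisibility needs `p` odd; the extra one is the prime `2 ^ 1 + 1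
= 3` at the start. -/
theorem cardFactors_add_one_le_cardFactors_two_pow_add_one {k : ℕ} (hk : Odd k) :
    cardFactors k + 1 ≤ cardFactors (2 ^ k + 1) := by
  induction k using induction_on_primes with
  | zero => simp at hk
  | one => simp [cardFactors_eq_one_iff_prime.mpr Nat.prime_three]
  | prime_mul p a hp ih =>
    have hpo : Odd p := (Nat.odd_mul.mp hk).1
    have hao : Odd a := (Nat.odd_mul.mp hk).2
    have ha : 0 < a := hao.pos
    have h2 : 2 ^ a < 2 ^ (p * a) := by
      have := Nat.mul_le_mul_right a hp.two_le
      exact Nat.pow_lt_pow_right (by norm_num) (by omega)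
    have hdvd : 2 ^ a + 1 ∣ 2 ^ (p * a) + 1 := by
      simpa [← pow_mul, mul_comm] using Odd.nat_add_dvd_pow_add_pow (2 ^ a) 1 hpo
    have := cardFactors_add_one_le_of_dvd_of_lt hdvd (Nat.succ_lt_succ h2) (Nat.succ_ne_zero _)
    rw [cardFactors_prime_mul hp ha.ne']
    have := ih hao
    omega

theorem cardFactors_prod_of_prime {n : ℕ} {p : Fin n → ℕ} (hp : ∀ i, (p i).Prime) :
    cardFactors (∏ i, p i) = n := by
  induction n with
  | zero => simp
  | succ n ih =>
    rw [Fin.prod_univ_succ, cardFactors_prime_mul (hp 0)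
      (Finset.prod_ne_zero_iff.mpr fun i _ => (hp _).ne_zero), ih fun i => hp _]

end Arithmetic

/-! ### Chains from an arbitrary subgroup, and their transport. -/

section Chains

/-- There is a chain of length `t` from `K` down to the trivial subgroup, each term of which is
maximal in the preceding one. -/
inductive HasUnrefinableChain {G : Type*} [Group G] : Subgroup G → ℕ → Prop
  | bot : HasUnrefinableChain ⊥ 0
  | cons {K L : Subgroup G} {t : ℕ} :
      L ⋖ K → HasUnrefinableChain L t → HasUnrefinableChain K (t + 1)

namespace HasUnrefinableChain

variable {G Γ : Type*} [Group G] [Group Γ]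

theorem of_isUnrefinableChain {t : ℕ} {H : ℕ → Subgroup G} (h : IsUnrefinableChain t H) :
    HasUnrefinableChain (⊤ : Subgroup G) t := by
  obtain ⟨h0, ht, hs⟩ := h
  rw [← h0]
  clear h0
  induction t generalizing H with
  | zero => exact ht ▸ .bot
  | succ t ih =>
    exact .cons (hs 0 t.succ_pos)
      (ih (H := fun i => H (i + 1)) ht fun i hi => hs (i + 1) (Nat.succ_lt_succ hi))

/-- Subgroups below the image of `f` are images of their preimages, so covers pull back. This serves
conjugates, subgroups regarded as groups, and `SL(2)` of a subfield. -/
theorem of_map {f : Γ →* G} (hf : Function.Injective f) {K : Subgroup Γ} {t : ℕ}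
    (h : HasUnrefinableChain (K.map f) t) : HasUnrefinableChain K t := by
  generalize hM : K.map f = M at h
  induction h generalizing K with
  | bot => rw [(Subgroup.map_eq_bot_iff_of_injective _ hf).mp hM]; exact .bot
  | @cons M L t hLM _ ih =>
    subst hM
    have hL : (L.comap f).map f = L :=
      Subgroup.map_comap_eq_self (hLM.le.trans (f.range_eq_map ▸ Subgroup.map_mono le_top))
    refine .cons (L := L.comap f) ?_ (ih hL)
    rw [← hL] at hLM
    refine ⟨(Subgroup.map_lt_map_iff_of_injective hf).mp hLM.lt, fun S h1 h2 => ?_⟩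
    exact hLM.2 ((Subgroup.map_lt_map_iff_of_injective hf).mpr h1)
      ((Subgroup.map_lt_map_iff_of_injective hf).mpr h2)

theorem top_of_range {f : Γ →* G} (hf : Function.Injective f) {t : ℕ}
    (h : HasUnrefinableChain f.range t) : HasUnrefinableChain (⊤ : Subgroup Γ) t :=
  of_map hf (f.range_eq_map ▸ h)

theorem top_of_subgroup {K : Subgroup G} {t : ℕ} (h : HasUnrefinableChain K t) :
    HasUnrefinableChain (⊤ : Subgroup K) t :=
  top_of_range K.subtype_injective (K.range_subtype.symm ▸ h)

end HasUnrefinableChain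

theorem le_groupDepth_of_forall {G : Type*} [Group G] [Finite G] {n : ℕ}
    (h : ∀ t, HasUnrefinableChain (⊤ : Subgroup G) t → n ≤ t) : n ≤ groupDepth G := by
  obtain ⟨H, hH⟩ := exists_isUnrefinableChain_groupDepth G
  exact h _ (.of_isUnrefinableChain hH)

end Chains

/-! ### Lower bounds for chain lengths from indices. -/

section Index

open ArithmeticFunction

variable {Γ : Type*} [Group Γ]

theorem exists_pow_notMem_pow_prime_mem [Finite Γ] {L : Subgroup Γ} {y : Γ} (hy : y ∉ L) :
    ∃ (d p : ℕ), p.Prime ∧ y ^ d ∉ L ∧ (y ^ d) ^ p ∈ L := by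
  classical
  have hex : ∃ n, 0 < n ∧ y ^ n ∈ L :=
    ⟨orderOf y, orderOf_pos y, by rw [pow_orderOf_eq_one]; exact L.one_mem⟩
  have hpos := (Nat.find_spec hex).1
  have hmem := (Nat.find_spec hex).2
  have hne : Nat.find hex ≠ 1 := fun h => hy (by rw [h] at hmem; simpa using hmem)
  have hp := Nat.minFac_prime hne
  refine ⟨Nat.find hex / (Nat.find hex).minFac, _, hp, fun h => ?_, ?_⟩
  · exact Nat.find_min hex (Nat.div_lt_self hpos hp.one_lt)
      ⟨Nat.div_pos (Nat.minFac_le hpos) hp.pos, h⟩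
  · rw [← pow_mul, Nat.div_mul_cancel (Nat.minFac_dvd _)]
    exact hmem

theorem relIndex_zpowers_eq_prime {L : Subgroup Γ} {y : Γ} {p : ℕ} (hp : p.Prime) (hy : y ∉ L)
    (hyp : y ^ p ∈ L) : L.relIndex (Subgroup.zpowers y) = p := by
  have : Fact p.Prime := ⟨hp⟩
  let y' : Subgroup.zpowers y := ⟨y, Subgroup.mem_zpowers y⟩
  let π := QuotientGroup.mk' (L.subgroupOf (Subgroup.zpowers y))
  have h1 : orderOf (π y') = p := by
    refine orderOf_eq_prime ?_ ?_
    · rw [← map_pow]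
      exact (QuotientGroup.eq_one_iff (y' ^ p)).mpr hyp
    · exact fun h => hy ((QuotientGroup.eq_one_iff y').mp h)
  rw [Subgroup.relIndex, Subgroup.index_eq_card, ← h1, ← orderOf_eq_card_of_forall_mem_zpowers]
  intro x
  obtain ⟨⟨_, n, rfl⟩, rfl⟩ := QuotientGroup.mk'_surjective _ x
  exact ⟨n, (map_zpow π y' n).symm⟩

/-- Some power of `y` generates a normal subgroup `N` with `L ⊓ N` of prime index `p` in `N`.
Maximality gives `L ⊔ N = K`, so `L` has index `p` in `K`. -/
theorem cardFactors_card_le_of_covBy [Finite Γ] {K L : Subgroup Γ} (hLK : L ⋖ K) {y : Γ}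
    (hyK : y ∈ K) (hyL : y ∉ L) (hy : ∀ n : ℕ, (Subgroup.zpowers (y ^ n)).Normal) :
    cardFactors (Nat.card K) ≤ cardFactors (Nat.card L) + 1 := by
  obtain ⟨d, p, hp, h1, h2⟩ := exists_pow_notMem_pow_prime_mem hyL
  have := hy d
  set N := Subgroup.zpowers (y ^ d) with hN
  have hNK : N ≤ K := by
    rw [hN, Subgroup.zpowers_le]; exact K.pow_mem hyK d
  have hsup : L ⊔ N = K := by
    refine (hLK.eq_or_eq le_sup_left (sup_le hLK.le hNK)).resolve_left fun h => h1 ?_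
    exact (h ▸ le_sup_right : N ≤ L) (Subgroup.mem_zpowers _)
  have e1 : L.relIndex N = p := relIndex_zpowers_eq_prime hp h1 h2
  have e2 : N.relIndex K = N.relIndex L := by rw [← hsup, Subgroup.relIndex_sup_right]
  have cK := Subgroup.relIndex_mul_relIndex ⊥ N K bot_le hNK
  have cN := Subgroup.relIndex_mul_relIndex ⊥ (L ⊓ N) N bot_le inf_le_right
  have cL := Subgroup.relIndex_mul_relIndex ⊥ (L ⊓ N) L bot_le inf_le_left
  simp only [Subgroup.relIndex_bot_left, Subgroup.inf_relIndex_right,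
    Subgroup.inf_relIndex_left, e1, e2] at cK cN cL
  have : Nat.card K = p * Nat.card L := by rw [← cK, ← cN, ← cL]; ring
  rw [this, cardFactors_prime_mul hp Nat.card_pos.ne']

theorem cardFactors_card_le_of_wcovBy_of_comm {A : Type*} [CommGroup A] [Finite A]
    {K L : Subgroup A} (h : L ⩿ K) :
    cardFactors (Nat.card K) ≤ cardFactors (Nat.card L) + 1 := by
  rcases h.covBy_or_eq with h | rfl
  · obtain ⟨y, hyK, hyL⟩ := SetLike.exists_of_lt h.lt
    exact cardFactors_card_le_of_covBy h hyK hyL fun n => inferInstance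
  · omega

/-- A subgroup `S` between the images is the image of `S.comap f ⊓ K`, which lies between `L` and
`K`. -/
theorem map_wcovBy_map {Γ' : Type*} [Group Γ'] (f : Γ →* Γ') {K L : Subgroup Γ} (h : L ⋖ K) :
    L.map f ⩿ K.map f := by
  refine ⟨Subgroup.map_mono h.le, fun S h1 h2 => ?_⟩
  have e : (S.comap f ⊓ K).map f = S := by
    refine le_antisymm (Subgroup.map_le_iff_le_comap.mpr inf_le_left) fun z hz => ?_
    obtain ⟨k, hk, rfl⟩ := h2.le hz
    exact ⟨k, ⟨hz, hk⟩, rfl⟩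
  rcases h.eq_or_eq (c := S.comap f ⊓ K)
    (le_inf (Subgroup.map_le_iff_le_comap.mp h1.le) h.le) inf_le_right with h' | h'
  · exact h1.ne (by rw [← h', e])
  · exact h2.ne (by rw [← h', e])

theorem cardFactors_card_map_le_of_chain {A : Type*} [CommGroup A] [Finite A] (f : Γ →* A)
    {K : Subgroup Γ} {t : ℕ} (h : HasUnrefinableChain K t) :
    cardFactors (Nat.card (K.map f)) ≤ t := by
  induction h with
  | bot => simp
  | cons h _ ih =>
    have := cardFactors_card_le_of_wcovBy_of_comm (map_wcovBy_map f h)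
    omega

/-- A chain from a subgroup containing the nontrivial kernel of a homomorphism to an abelian
group `A` has a step at which the image in `A` does not change. -/
theorem cardFactors_card_map_add_one_le_of_chain {A : Type*} [CommGroup A] [Finite A] {f : Γ →* A}
    (hf : f.ker ≠ ⊥) {K : Subgroup Γ} {t : ℕ} (h : HasUnrefinableChain K t) (hK : f.ker ≤ K) :
    cardFactors (Nat.card (K.map f)) + 1 ≤ t := by
  induction h with
  | bot => exact absurd (le_bot_iff.mp hK) hf
  | @cons K L t h hL ih =>
    by_cases hfL : f.ker ≤ L
    · have := cardFactors_card_le_of_wcovBy_of_comm (map_wcovBy_map f h)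
      have := ih hfL
      omega
    · have hsup : L ⊔ f.ker = K := by
        refine (h.eq_or_eq le_sup_left (sup_le h.le hK)).resolve_left fun h' => hfL ?_
        exact h' ▸ le_sup_right
      have : K.map f = L.map f := by
        rw [← hsup, Subgroup.map_sup, (Subgroup.map_eq_bot_iff _).mpr le_rfl, sup_bot_eq]
      rw [this]
      have := cardFactors_card_map_le_of_chain f hL
      omega

/-- In a group with a subgroup `A` of index at most two, each of whose elements is centralized or
inverted by each element of the group, chains of `K` are at least as long as the number of prime
factors of the order of `K`. -/
theorem cardFactors_card_le_of_chain_of_inverts [Finite Γ] {A : Subgroup Γ}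
    (hinv : ∀ g, ∀ y ∈ A, g * y * g⁻¹ = y ∨ g * y * g⁻¹ = y⁻¹)
    (hA : ∀ g h, g ∉ A → h ∉ A → g * h ∈ A) {K : Subgroup Γ} {t : ℕ}
    (h : HasUnrefinableChain K t) : cardFactors (Nat.card K) ≤ t := by
  induction h with
  | bot => simp
  | @cons K L t h hL ih =>
    suffices cardFactors (Nat.card K) ≤ cardFactors (Nat.card L) + 1 by omega
    -- Either elements of `K` outside `L` are outside `A`, so that products of two of them lie in
    -- `L` and the index divides two, or some `y ∈ A ⊓ K` lies outside `L` and its powers generate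
    -- normal subgroups.
    by_cases hAL : A ⊓ K ≤ L
    · have hi : L.relIndex K ∣ 2 := by
        obtain ⟨a, haK, haL⟩ := SetLike.exists_of_lt h.lt
        rw [Subgroup.relIndex_dvd_two_iff]
        refine ⟨a, haK, fun b hb => ?_⟩
        by_cases hbA : b ∈ A
        · exact .inr (hAL ⟨hbA, hb⟩)
        · exact .inl (hAL ⟨hA _ _ hbA fun haA => haL (hAL ⟨haA, haK⟩), K.mul_mem hb haK⟩)
      have c := Subgroup.relIndex_mul_relIndex ⊥ L K bot_le h.le
      rw [Subgroup.relIndex_bot_left, Subgroup.relIndex_bot_left] at c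
      rcases (Nat.dvd_prime Nat.prime_two).mp hi with h2 | h2 <;> rw [← c, h2]
      · simp
      · rw [mul_comm, cardFactors_prime_mul Nat.prime_two Nat.card_pos.ne']
    · obtain ⟨y, ⟨hyA, hyK⟩, hyL⟩ := SetLike.not_le_iff_exists.mp hAL
      refine cardFactors_card_le_of_covBy h hyK hyL fun n => ⟨fun z hz g => ?_⟩
      obtain ⟨m, rfl⟩ := Subgroup.mem_zpowers_iff.mp hz
      rw [← conj_zpow]
      refine Subgroup.zpow_mem _ ?_ m
      rcases hinv g _ (A.pow_mem hyA n) with h' | h' <;> rw [h']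
      · exact Subgroup.mem_zpowers _
      · exact Subgroup.inv_mem _ (Subgroup.mem_zpowers _)

end Index

/-! ### Matrix computations in `SL(2)`, mostly in characteristic two. -/

open scoped MatrixGroups

namespace SL2

section CommRing

variable {R : Type*} [CommRing R]

/-- The matrix with rows `a b` and `c d`. -/
def mk (a b c d : R) (h : a * d - b * c = 1) : SL(2, R) :=
  ⟨!![a, b; c, d], by rw [Matrix.det_fin_two_of, h]⟩

section entries
variable (a b c d : R) (h : a * d - b * c = 1)
@[simp] theorem mk_00 : mk a b c d h 0 0 = a := rfl
@[simp] theorem mk_01 : mk a b c d h 0 1 = b := rfl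
@[simp] theorem mk_10 : mk a b c d h 1 0 = c := rfl
@[simp] theorem mk_11 : mk a b c d h 1 1 = d := rfl
end entries

theorem ext_entries {g h : SL(2, R)} (h00 : g 0 0 = h 0 0) (h01 : g 0 1 = h 0 1)
    (h10 : g 1 0 = h 1 0) (h11 : g 1 1 = h 1 1) : g = h := by
  ext i j
  fin_cases i <;> fin_cases j <;> assumption

theorem mul_entry (g h : SL(2, R)) (i j : Fin 2) :
    (g * h) i j = g i 0 * h 0 j + g i 1 * h 1 j := by
  simp [Matrix.mul_apply, Fin.sum_univ_two]

@[simp] theorem one_00 : (1 : SL(2, R)) 0 0 = 1 := rfl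
@[simp] theorem one_01 : (1 : SL(2, R)) 0 1 = 0 := rfl
@[simp] theorem one_10 : (1 : SL(2, R)) 1 0 = 0 := rfl
@[simp] theorem one_11 : (1 : SL(2, R)) 1 1 = 1 := rfl

section inv
variable (g : SL(2, R))
@[simp] theorem inv_00 : g⁻¹ 0 0 = g 1 1 := by
  rw [Matrix.SpecialLinearGroup.SL2_inv_expl]; rfl
@[simp] theorem inv_01 : g⁻¹ 0 1 = -g 0 1 := by
  rw [Matrix.SpecialLinearGroup.SL2_inv_expl]; rfl
@[simp] theorem inv_10 : g⁻¹ 1 0 = -g 1 0 := by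
  rw [Matrix.SpecialLinearGroup.SL2_inv_expl]; rfl
@[simp] theorem inv_11 : g⁻¹ 1 1 = g 0 0 := by
  rw [Matrix.SpecialLinearGroup.SL2_inv_expl]; rfl
end inv

theorem det_eq (g : SL(2, R)) : g 0 0 * g 1 1 - g 0 1 * g 1 0 = 1 := by
  have := g.det_coe
  rwa [Matrix.det_fin_two] at this

/-- Upper unitriangular matrices. -/
def upper (v : R) : SL(2, R) := mk 1 v 0 1 (by ring)

/-- Lower unitriangular matrices. -/
def lower (v : R) : SL(2, R) := mk 1 0 v 1 (by ring)

section entries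
variable (v : R)
@[simp] theorem upper_00 : upper v 0 0 = 1 := rfl
@[simp] theorem upper_01 : upper v 0 1 = v := rfl
@[simp] theorem upper_10 : upper v 1 0 = 0 := rfl
@[simp] theorem upper_11 : upper v 1 1 = 1 := rfl
@[simp] theorem lower_00 : lower v 0 0 = 1 := rfl
@[simp] theorem lower_01 : lower v 0 1 = 0 := rfl
@[simp] theorem lower_10 : lower v 1 0 = v := rfl
@[simp] theorem lower_11 : lower v 1 1 = 1 := rfl
end entries

theorem upper_mul_upper (v w : R) : upper v * upper w = upper (v + w) := by
  apply ext_entries <;> simp [mul_entry, add_comm]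

theorem upper_zero : upper (0 : R) = 1 := by apply ext_entries <;> simp

theorem upper_inv (v : R) : (upper v)⁻¹ = upper (-v) := by
  apply ext_entries <;> simp

theorem upper_injective : Function.Injective (upper : R → SL(2, R)) := fun v w h => by
  rw [← upper_01 v, h, upper_01]

variable (R) in
/-- The upper triangular matrices. -/
def borel : Subgroup SL(2, R) where
  carrier := {g | g 1 0 = 0}
  one_mem' := rfl
  mul_mem' {g h} hg hh := by
    simp only [Set.mem_ofPred_eq] at *
    simp [mul_entry, hg, hh]
  inv_mem' {g} hg := by
    simp only [Set.mem_ofPred_eq] at *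
    simp [hg]

theorem mem_borel {g : SL(2, R)} : g ∈ borel R ↔ g 1 0 = 0 := Iff.rfl

end CommRing

section Field

variable {F : Type*} [Field F]

/-- Diagonal matrices. -/
def diag (a : F) (ha : a ≠ 0) : SL(2, F) := mk a 0 0 a⁻¹ (by simp [ha])

section entries
variable (a : F) (ha : a ≠ 0)
@[simp] theorem diag_00 : diag a ha 0 0 = a := rfl
@[simp] theorem diag_01 : diag a ha 0 1 = 0 := rfl
@[simp] theorem diag_10 : diag a ha 1 0 = 0 := rfl
@[simp] theorem diag_11 : diag a ha 1 1 = a⁻¹ := rfl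
end entries

/-- The upper and lower unitriangular matrices generate `SL(2, F)`. -/
theorem eq_top_of_upper_of_lower {H : Subgroup SL(2, F)} (hu : ∀ v, upper v ∈ H)
    (hl : ∀ v, lower v ∈ H) : H = ⊤ := by
  have key : ∀ g : SL(2, F), g 1 0 ≠ 0 → g ∈ H := by
    intro g hg
    have : g = upper ((g 0 0 - 1) / g 1 0) * lower (g 1 0) * upper ((g 1 1 - 1) / g 1 0) := by
      have := det_eq g
      apply ext_entries <;> simp [mul_entry] <;> field_simp
      · ring
      · linear_combination -this
      · ring
    rw [this]
    exact H.mul_mem (H.mul_mem (hu _) (hl _)) (hu _)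
  rw [eq_top_iff]
  intro g _
  by_cases hg : g 1 0 = 0
  · have h1 : lower 1 * g ∈ H := key _ (by
      have := det_eq g
      rw [hg] at this
      simp only [mul_entry, lower_10, lower_11, hg]
      intro h0
      simp at h0
      simp [h0] at this)
    exact (H.mul_mem_cancel_left (hl 1)).mp h1
  · exact key g hg

variable [CharP F 2]

/-- By Cayley–Hamilton `g² = tr(g) g + 1`, so squaring to one means trace zero. Below, equality of
the diagonal entries is the working form of "involution or identity". -/
theorem mul_self_eq_one_iff {g : SL(2, F)} : g * g = 1 ↔ g 0 0 = g 1 1 := by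
  have h2 : (2 : F) = 0 := CharTwo.two_eq_zero
  have hd := det_eq g
  constructor
  · intro h
    have e00 := congrArg (fun g : SL(2, F) => g 0 0) h
    have e01 := congrArg (fun g : SL(2, F) => g 0 1) h
    have e10 := congrArg (fun g : SL(2, F) => g 1 0) h
    have e11 := congrArg (fun g : SL(2, F) => g 1 1) h
    simp only [mul_entry, one_00, one_01, one_10, one_11] at e00 e01 e10 e11
    have : (g 0 0 - g 1 1) ^ 2 = 0 := by
      linear_combination e00 + e11 - 2 * hd - (2 * g 0 1 * g 1 0) * h2
    exact sub_eq_zero.mp (pow_eq_zero_iff two_ne_zero |>.mp this)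
  · intro h
    rw [← h] at hd
    apply ext_entries <;> simp only [mul_entry, one_00, one_01, one_10, one_11, ← h]
    · linear_combination hd + g 0 1 * g 1 0 * h2
    · linear_combination g 0 0 * g 0 1 * h2
    · linear_combination g 0 0 * g 1 0 * h2
    · linear_combination hd + g 0 1 * g 1 0 * h2

theorem nonscalar {x : SL(2, F)} (hx : x ≠ 1) : x 0 1 ≠ 0 ∨ x 1 0 ≠ 0 ∨ x 0 0 ≠ x 1 1 := by
  by_contra! h
  obtain ⟨h01, h10, h00⟩ := h
  have hd := det_eq x
  rw [h01, ← h00] at hd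
  have : x 0 0 = 1 := by
    have h2 : (2 : F) = 0 := CharTwo.two_eq_zero
    have : (x 0 0 - 1) ^ 2 = 0 := by linear_combination hd - (x 0 0 - 1) * h2
    exact sub_eq_zero.mp (pow_eq_zero_iff two_ne_zero |>.mp this)
  exact hx (ext_entries this h01 h10 (h00 ▸ this))

/-- The commutant of a nonscalar 2×2 matrix `x` is `F[x]`, and in characteristic two the only scalar
of determinant one is the identity. -/
theorem exists_of_commute {x y : SL(2, F)} (hx : x ≠ 1) (h : x * y = y * x) :
    ∃ α β : F, y 0 0 = α + β * x 0 0 ∧ y 0 1 = β * x 0 1 ∧ y 1 0 = β * x 1 0 ∧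
      y 1 1 = α + β * x 1 1 := by
  have e00 := congrArg (fun g : SL(2, F) => g 0 0) h
  have e01 := congrArg (fun g : SL(2, F) => g 0 1) h
  have e10 := congrArg (fun g : SL(2, F) => g 1 0) h
  simp only [mul_entry] at e00 e01 e10
  rcases nonscalar hx with h | h | h
  · refine ⟨y 0 0 - y 0 1 / x 0 1 * x 0 0, y 0 1 / x 0 1, ?_, ?_, ?_, ?_⟩ <;> field_simp
    · ring
    · linear_combination e00
    · linear_combination e01
  · refine ⟨y 0 0 - y 1 0 / x 1 0 * x 0 0, y 1 0 / x 1 0, ?_, ?_, ?_, ?_⟩ <;> field_simp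
    · ring
    · linear_combination -e00
    · linear_combination -e10
  · have h' : x 0 0 - x 1 1 ≠ 0 := sub_ne_zero.mpr h
    refine ⟨y 0 0 - (y 0 0 - y 1 1) / (x 0 0 - x 1 1) * x 0 0,
      (y 0 0 - y 1 1) / (x 0 0 - x 1 1), ?_, ?_, ?_, ?_⟩ <;> field_simp
    · ring
    · linear_combination e01
    · linear_combination -e10
    · ring

/-- Centralizers of nontrivial elements are abelian. -/
theorem commute_of_commute {x y z : SL(2, F)} (hx : x ≠ 1) (hy : x * y = y * x)
    (hz : x * z = z * x) : y * z = z * y := by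
  obtain ⟨α, β, a1, a2, a3, a4⟩ := exists_of_commute hx hy
  obtain ⟨γ, δ, b1, b2, b3, b4⟩ := exists_of_commute hx hz
  apply ext_entries <;> simp only [mul_entry, a1, a2, a3, a4, b1, b2, b3, b4] <;> ring

/-- An element `g` such that `x` commutes with its conjugate by `g` centralizes `x`, or is an
involution inverting it, provided that `x` is not an involution. -/
theorem conj_eq_or_of_commute {x g : SL(2, F)} (hx : x 0 0 ≠ x 1 1)
    (h : x * (g * x * g⁻¹) = (g * x * g⁻¹) * x) :
    g * x * g⁻¹ = x ∨ (g * x * g⁻¹ = x⁻¹ ∧ g 0 0 = g 1 1) := by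
  have h2 : (2 : F) = 0 := CharTwo.two_eq_zero
  have hx1 : x ≠ 1 := fun h => hx (by rw [h]; rfl)
  obtain ⟨α, β, a1, a2, a3, a4⟩ := exists_of_commute hx1 h
  have hg := det_eq g
  have hxd := det_eq x
  set y := g * x * g⁻¹ with hy
  have hyd := det_eq y
  have htr : y 0 0 + y 1 1 = x 0 0 + x 1 1 := by
    simp only [hy, mul_entry, inv_00, inv_01, inv_10, inv_11]
    linear_combination (x 0 0 + x 1 1) * hg
  have ht : x 0 0 + x 1 1 ≠ 0 := fun h0 => hx (by linear_combination h0 - x 1 1 * h2)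
  -- Write the conjugate as `α + β x`. Equal nonzero traces force `β = 1`; equal determinants then
  -- leave `α = 0` or `α = tr x`, and `x + tr x = x⁻¹`.
  have hβ : β = 1 := by
    have : (x 0 0 + x 1 1) * (β - 1) = 0 := by
      linear_combination htr - a1 - a4 - α * h2
    exact sub_eq_zero.mp ((mul_eq_zero.mp this).resolve_left ht)
  rw [hβ, one_mul] at a1 a2 a3 a4
  have hα : α * (α + (x 0 0 + x 1 1)) = 0 := by
    rw [a1, a2, a3, a4] at hyd
    linear_combination hyd - hxd
  rcases mul_eq_zero.mp hα with h0 | h0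
  · left
    rw [h0, zero_add] at a1 a4
    exact ext_entries a1 a2 a3 a4
  · right
    have hinv : y = x⁻¹ := by
      apply ext_entries <;> simp only [inv_00, inv_01, inv_10, inv_11, a1, a2, a3, a4]
      · linear_combination h0 - x 1 1 * h2
      · linear_combination x 0 1 * h2
      · linear_combination x 1 0 * h2
      · linear_combination h0 - x 0 0 * h2
    refine ⟨hinv, ?_⟩
    have hgx : g * x = x⁻¹ * g := by rw [← hinv, hy]; group
    have e00 := congrArg (fun g : SL(2, F) => g 0 0) hgx
    have e11 := congrArg (fun g : SL(2, F) => g 1 1) hgx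
    simp only [mul_entry, inv_00, inv_01, inv_10, inv_11] at e00 e11
    have : (x 0 0 + x 1 1) * (g 0 0 - g 1 1) = 0 := by
      linear_combination e00 + e11 +
        (x 1 1 * g 0 0 - x 1 1 * g 1 1 - g 0 1 * x 1 0 - g 1 0 * x 0 1) * h2
    exact sub_eq_zero.mp ((mul_eq_zero.mp this).resolve_left ht)

end Field

end SL2

/-! ### Tori, their orders and their dihedral normalizers. -/

namespace SL2

open ArithmeticFunction

section Torus

/-- The subgroup of elements that centralize or invert `x`. -/
def dihedralNormalizer {G : Type*} [Group G] (x : G) : Subgroup G where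
  carrier := {g | g * x * g⁻¹ = x ∨ g * x * g⁻¹ = x⁻¹}
  one_mem' := .inl (by simp)
  mul_mem' {g h} hg hh := by
    have key : g * h * x * (g * h)⁻¹ = g * (h * x * h⁻¹) * g⁻¹ := by group
    have key' : g * x⁻¹ * g⁻¹ = (g * x * g⁻¹)⁻¹ := by group
    simp only [Set.mem_ofPred_eq, key] at *
    rcases hh with hh | hh <;> rcases hg with hg | hg <;> simp [hh, key', hg]
  inv_mem' {g} hg := by
    simp only [Set.mem_ofPred_eq, inv_inv] at *
    rcases hg with hg | hg
    · left; nth_rewrite 1 [← hg]; group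
    · right
      have : x = (g * x * g⁻¹)⁻¹ := by rw [hg, inv_inv]
      nth_rewrite 1 [this]; group

theorem centralizer_le_dihedralNormalizer {G : Type*} [Group G] (x : G) :
    Subgroup.centralizer {x} ≤ dihedralNormalizer x := fun g hg =>
  .inl (by rw [Subgroup.mem_centralizer_singleton_iff.mp hg]; group)

variable {F : Type*} [Field F] [CharP F 2]

theorem mul_self_eq_one_of_mem_dihedralNormalizer {x g : SL(2, F)} (hx : x 0 0 ≠ x 1 1)
    (hg : g ∈ dihedralNormalizer x) (hgx : g ∉ Subgroup.centralizer {x}) : g * g = 1 := by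
  have h1 : g * x * g⁻¹ ≠ x := fun h => hgx (by
    rw [Subgroup.mem_centralizer_singleton_iff]; nth_rewrite 2 [← h]; group)
  have h2 := hg.resolve_left h1
  have := (conj_eq_or_of_commute hx (g := g) (by rw [h2]; group)).resolve_left h1
  exact mul_self_eq_one_iff.mpr this.2

/-- The abelian centralizer of `x` plays the role of `A`. For `g` outside it and `y` in it, `g` and
`g * y` both square to one, hence `g` inverts `y`. -/
theorem cardFactors_card_dihedralNormalizer_le [Finite F] {x : SL(2, F)} (hx : x 0 0 ≠ x 1 1)
    {t : ℕ} (h : HasUnrefinableChain (dihedralNormalizer x) t) :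
    cardFactors (Nat.card (dihedralNormalizer x)) ≤ t := by
  have hx1 : x ≠ 1 := fun h => hx (by rw [h]; rfl)
  have := cardFactors_card_le_of_chain_of_inverts
    (A := (Subgroup.centralizer {x}).subgroupOf (dihedralNormalizer x)) ?_ ?_ h.top_of_subgroup
  · rwa [Subgroup.card_top] at this
  · rintro ⟨g, hg⟩ ⟨y, hy'⟩ hy
    rw [Subgroup.mem_subgroupOf] at hy
    simp only [Subtype.ext_iff, Subgroup.coe_mul, Subgroup.coe_inv] at *
    have hyx := Subgroup.mem_centralizer_singleton_iff.mp hy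
    by_cases hgx : g ∈ Subgroup.centralizer {x}
    · left
      rw [commute_of_commute hx1 (Subgroup.mem_centralizer_singleton_iff.mp hgx).symm hyx.symm]
      group
    · right
      have h1 := mul_self_eq_one_of_mem_dihedralNormalizer hx hg hgx
      have h2 := mul_self_eq_one_of_mem_dihedralNormalizer hx
        (mul_mem hg hy') (fun h => hgx ((Subgroup.mul_mem_cancel_right _ hy).mp h))
      rw [inv_eq_of_mul_eq_one_left h1, eq_inv_iff_mul_eq_one]
      simpa only [mul_assoc] using h2
  · rintro ⟨g, hg⟩ ⟨h, hh⟩ hgx hhx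
    rw [Subgroup.mem_subgroupOf, Subgroup.mem_centralizer_singleton_iff] at *
    simp only [Subgroup.coe_mul] at *
    have h1 : g * x * g⁻¹ = x⁻¹ :=
      hg.resolve_left fun h => hgx (by nth_rewrite 2 [← h]; group)
    have h2 : h * x * h⁻¹ = x⁻¹ :=
      hh.resolve_left fun h => hhx (by nth_rewrite 2 [← h]; group)
    have h3 : g * h * x * (g * h)⁻¹ = x := by
      calc g * h * x * (g * h)⁻¹ = g * (h * x * h⁻¹) * g⁻¹ := by group
        _ = (g * x * g⁻¹)⁻¹ := by rw [h2]; group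
        _ = x := by rw [h1, inv_inv]
    nth_rewrite 2 [← h3]
    group

/-- Otherwise every element of nonzero trace commutes with `x`. Applied to `diag a` and `upper 1 *
diag a`, this makes `upper 1` commute with `x`, which contradicts `hx`. -/
theorem dihedralNormalizer_ne_top {x : SL(2, F)} (hx : x 0 0 ≠ x 1 1) {a : F} (ha : a ≠ 0)
    (ha1 : a ≠ 1) : dihedralNormalizer x ≠ ⊤ := by
  intro htop
  have key : ∀ g : SL(2, F), g 0 0 ≠ g 1 1 → g * x = x * g := by
    intro g hg
    by_contra h
    exact hg (mul_self_eq_one_iff.mp (mul_self_eq_one_of_mem_dihedralNormalizer hx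
      (htop ▸ Subgroup.mem_top g) fun h' => h (Subgroup.mem_centralizer_singleton_iff.mp h')))
  have haa : a ≠ a⁻¹ := fun h => ha1 (by
    have h2 : (2 : F) = 0 := CharTwo.two_eq_zero
    have h3 : a * a = 1 := by nth_rewrite 2 [h]; exact mul_inv_cancel₀ ha
    have : (a - 1) ^ 2 = 0 := by linear_combination h3 - (a - 1) * h2
    exact sub_eq_zero.mp (pow_eq_zero_iff two_ne_zero |>.mp this))
  have h1 := key (diag a ha) haa
  have h2 := key (upper 1 * diag a ha) (by simpa [mul_entry] using haa)
  have h3 : upper 1 * x = x * upper 1 := by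
    rw [mul_assoc, h1, ← mul_assoc, ← mul_assoc] at h2
    exact mul_right_cancel h2
  have e01 := congrArg (fun g : SL(2, F) => g 0 1) h3
  simp [mul_entry] at e01
  exact hx (by linear_combination -e01)

theorem exists_sq_eq [Finite F] (a : F) : ∃ r : F, r ^ 2 = a := by
  obtain ⟨r, hr⟩ := FiniteField.isSquare_of_char_two (ringChar.eq F 2 |>.symm ▸ rfl) a
  exact ⟨r, by rw [hr, sq]⟩

theorem sq_inj {a b : F} (h : a ^ 2 = b ^ 2) : a = b := by
  have h2 : (2 : F) = 0 := CharTwo.two_eq_zero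
  have : (a - b) ^ 2 = 0 := by linear_combination h + (b ^ 2 - a * b) * h2
  exact sub_eq_zero.mp (pow_eq_zero_iff two_ne_zero |>.mp this)

/-- Up to scalars, the nonzero elements of `F[x]` are `1` and the `z + x`, with `det (z + x) = z² +
z tr(x) + 1`. Squaring is bijective on `F`, so each invertible class has exactly one representative
of determinant one. -/
theorem card_centralizer [Finite F] {x : SL(2, F)} (hx : x 0 0 ≠ x 1 1) :
    Nat.card (Subgroup.centralizer {x}) =
      {z : F | z ^ 2 + z * (x 0 0 + x 1 1) + 1 ≠ 0}.ncard + 1 := by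
  have hx1 : x ≠ 1 := fun h => hx (by rw [h]; rfl)
  have h2 : (2 : F) = 0 := CharTwo.two_eq_zero
  have hxd := det_eq x
  have hx' : x 0 0 - x 1 1 ≠ 0 := sub_ne_zero.mpr hx
  set S := {z : F | z ^ 2 + z * (x 0 0 + x 1 1) + 1 ≠ 0} with hS
  choose r hr using fun z : F => exists_sq_eq (z ^ 2 + z * (x 0 0 + x 1 1) + 1)⁻¹
  have hr0 : ∀ z ∈ S, r z ≠ 0 := fun z hz h0 => by
    have := hr z
    rw [h0, eq_comm] at this
    exact hz (by simpa using this)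
  have hrs : ∀ z ∈ S, r z ^ 2 * (z ^ 2 + z * (x 0 0 + x 1 1) + 1) = 1 := fun z hz => by
    rw [hr]; exact inv_mul_cancel₀ hz
  let f : Option S → Subgroup.centralizer {x} := fun o => o.elim 1 fun z =>
    ⟨mk (r z * (z + x 0 0)) (r z * x 0 1) (r z * x 1 0) (r z * (z + x 1 1))
      (by linear_combination hrs z z.2 + (r z) ^ 2 * hxd), by
      rw [Subgroup.mem_centralizer_singleton_iff]
      apply ext_entries <;> simp [mul_entry] <;> ring⟩
  have hf : Function.Bijective f := by
    constructor
    · intro o o' hoo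
      have e00 := congrArg (fun g : Subgroup.centralizer {x} => g.1 0 0) hoo
      have e11 := congrArg (fun g : Subgroup.centralizer {x} => g.1 1 1) hoo
      rcases o with _ | z <;> rcases o' with _ | z'
      · rfl
      · simp [f] at e00 e11
        exact absurd (mul_eq_zero.mp (by linear_combination e11 - e00 :
          r z' * (x 0 0 - x 1 1) = 0)) (not_or.mpr ⟨hr0 _ z'.2, hx'⟩)
      · simp [f] at e00 e11
        exact absurd (mul_eq_zero.mp (by linear_combination e00 - e11 :
          r z * (x 0 0 - x 1 1) = 0)) (not_or.mpr ⟨hr0 _ z.2, hx'⟩)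
      · simp [f] at e00 e11
        have hrr : r z = r z' := mul_right_cancel₀ hx' (by linear_combination e00 - e11)
        rw [hrr] at e00
        have := mul_left_cancel₀ (hr0 _ z'.2) e00
        simpa [Subtype.ext_iff] using this
    · rintro ⟨y, hy⟩
      obtain ⟨α, β, a1, a2, a3, a4⟩ :=
        exists_of_commute hx1 (Subgroup.mem_centralizer_singleton_iff.mp hy).symm
      have hyd := det_eq y
      rw [a1, a2, a3, a4] at hyd
      by_cases hβ : β = 0
      · refine ⟨none, Subtype.ext ?_⟩
        simp only [hβ, zero_mul, add_zero] at a1 a2 a3 a4 hyd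
        have : α = 1 := sq_inj (by linear_combination hyd)
        rw [this] at a1 a4
        exact (ext_entries a1 a2 a3 a4).symm
      · have hz : β ^ 2 * ((α / β) ^ 2 + (α / β) * (x 0 0 + x 1 1) + 1) = 1 := by
          field_simp
          linear_combination hyd - β ^ 2 * hxd
        have hzS : α / β ∈ S := fun h0 => by rw [h0] at hz; simp at hz
        refine ⟨some ⟨α / β, hzS⟩, Subtype.ext ?_⟩
        have hrβ : r (α / β) = β :=
          sq_inj (mul_right_cancel₀ hzS ((hrs _ hzS).trans hz.symm))
        apply ext_entries <;> simp [f, hrβ, a1, a2, a3, a4] <;> field_simp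
  rw [← Nat.card_congr (Equiv.ofBijective f hf), Finite.card_option, Nat.card_coe_set_eq]

theorem card_centralizer_of_no_root [Finite F] {x : SL(2, F)} (hx : x 0 0 ≠ x 1 1)
    (h : ∀ z : F, z ^ 2 + z * (x 0 0 + x 1 1) + 1 ≠ 0) :
    Nat.card (Subgroup.centralizer {x}) = Nat.card F + 1 := by
  rw [card_centralizer hx, Set.eq_univ_of_forall (s := {z : F | _}) h, Set.ncard_univ]

theorem card_centralizer_of_root [Finite F] {x : SL(2, F)} (hx : x 0 0 ≠ x 1 1) {z : F}
    (h : z ^ 2 + z * (x 0 0 + x 1 1) + 1 = 0) :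
    Nat.card (Subgroup.centralizer {x}) = Nat.card F - 1 := by
  have h2 : (2 : F) = 0 := CharTwo.two_eq_zero
  have ht : x 0 0 + x 1 1 ≠ 0 := fun h0 => hx (by linear_combination h0 - x 1 1 * h2)
  have hS : {z : F | z ^ 2 + z * (x 0 0 + x 1 1) + 1 ≠ 0} = {z, z + (x 0 0 + x 1 1)}ᶜ := by
    ext w
    simp only [Set.mem_ofPred_eq, Set.mem_compl_iff, Set.mem_insert_iff, Set.mem_singleton_iff]
    refine not_congr ?_
    have : w ^ 2 + w * (x 0 0 + x 1 1) + 1 = (w - z) * (w - (z + (x 0 0 + x 1 1))) := by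
      linear_combination h + (w * (x 0 0 + x 1 1) + w * z - z ^ 2 - z * (x 0 0 + x 1 1)) * h2
    rw [this, mul_eq_zero, sub_eq_zero, sub_eq_zero]
  have hc := Set.ncard_add_ncard_compl ({z, z + (x 0 0 + x 1 1)} : Set F)
  rw [Set.ncard_pair (by simpa using ht)] at hc
  rw [card_centralizer hx, hS]
  omega

/-- The root is an eigenvalue, and its eigenvector is shared by all of `F[x]`; `g` moves the
eigenvector to the first coordinate axis. -/
theorem exists_conj_mem_borel_of_root {x : SL(2, F)} (hx : x ≠ 1) {l : F}
    (h : l ^ 2 + l * (x 0 0 + x 1 1) + 1 = 0) :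
    ∃ g : SL(2, F), ∀ y ∈ Subgroup.centralizer {x}, g * y * g⁻¹ ∈ borel F := by
  have h2 : (2 : F) = 0 := CharTwo.two_eq_zero
  have hxd := det_eq x
  by_cases h10 : x 1 0 = 0
  · refine ⟨1, fun y hy => ?_⟩
    obtain ⟨α, β, a1, a2, a3, a4⟩ :=
      exists_of_commute hx (Subgroup.mem_centralizer_singleton_iff.mp hy).symm
    simp [mem_borel, a3, h10]
  · refine ⟨mk 0 1 (-1) ((l - x 1 1) / x 1 0) (by ring), fun y hy => ?_⟩
    obtain ⟨α, β, a1, a2, a3, a4⟩ :=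
      exists_of_commute hx (Subgroup.mem_centralizer_singleton_iff.mp hy).symm
    simp only [mem_borel, mul_entry, mk_10, mk_11, inv_00, inv_10, a1, a2, a3, a4]
    field_simp
    linear_combination β * (h + hxd - l * (x 0 0 + x 1 1) * h2)

end Torus

/-! ### Chains from the Borel subgroup. -/

section Borel

variable {F : Type*} [Field F]

variable (F) in
/-- The upper left entry of an upper triangular matrix. -/
def borelChar : borel F →* Fˣ where
  toFun g := ⟨g.1 0 0, g.1 1 1,
    by have := det_eq g.1; rw [mem_borel.mp g.2] at this; simpa using this,
    by have := det_eq g.1; rw [mem_borel.mp g.2, mul_comm] at this; simpa using this⟩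
  map_one' := rfl
  map_mul' g h := by
    ext
    simp [mul_entry, mem_borel.mp h.2]

theorem cardFactors_add_one_le_of_chain_borel [Finite F] {t : ℕ}
    (h : HasUnrefinableChain (borel F) t) : cardFactors (Nat.card F - 1) + 1 ≤ t := by
  have hker : (borelChar F).ker ≠ ⊥ := fun h0 => by
    have : (⟨upper 1, rfl⟩ : borel F) ∈ (borelChar F).ker := Units.ext rfl
    rw [h0, Subgroup.mem_bot] at this
    have := congrArg (fun g : borel F => g.1 0 1) this
    simp at this
  have hsurj : Function.Surjective (borelChar F) := fun u =>
    ⟨⟨diag u u.ne_zero, rfl⟩, Units.ext rfl⟩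
  have := cardFactors_card_map_add_one_le_of_chain hker h.top_of_subgroup le_top
  rwa [Subgroup.map_top_of_surjective _ hsurj, Subgroup.card_top, Nat.card_units] at this

theorem borel_ne_top : borel F ≠ ⊤ := fun h => by
  have : lower (1 : F) ∈ borel F := h ▸ Subgroup.mem_top _
  simp [mem_borel] at this

end Borel

end SL2

/-! ### Subgroups without involutions, by transfer. -/

/-- A finite group in which centralizers of nontrivial elements are abelian, and in which no
nontrivial element commutes with a conjugate of itself other than itself, is abelian. -/
theorem mul_comm_of_centralizers_abelian (n : ℕ) : ∀ {Γ : Type*} [Group Γ] [Finite Γ],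
    Nat.card Γ = n →
    (∀ x y z : Γ, x ≠ 1 → x * y = y * x → x * z = z * x → y * z = z * y) →
    (∀ x g : Γ, x ≠ 1 → x * (g * x * g⁻¹) = g * x * g⁻¹ * x → g * x * g⁻¹ = x) →
    ∀ a b : Γ, a * b = b * a := by
  induction n using Nat.strong_induction_on with
  | _ n ih =>
  intro Γ _ _ hcard hc hn a b
  by_cases hΓ : Nat.card Γ = 1
  · have := (Nat.card_eq_one_iff_unique.mp hΓ).1
    exact Subsingleton.elim _ _
  have hp := Nat.minFac_prime hΓ
  set p := (Nat.card Γ).minFac with hpdef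
  have : Fact p.Prime := ⟨hp⟩
  let P : Sylow p Γ := default
  have hPne : (P : Subgroup Γ) ≠ ⊥ := P.ne_bot_of_dvd_card (Nat.minFac_dvd _)
  have : Nontrivial P := (Subgroup.nontrivial_iff_ne_bot _).mpr hPne
  have := P.isPGroup'.center_nontrivial
  obtain ⟨⟨⟨z, hzP⟩, hzc⟩, hz1⟩ := exists_ne (1 : Subgroup.center P)
  have hz1 : z ≠ 1 := fun h => hz1 (Subtype.ext (Subtype.ext h))
  have hzcomm : ∀ y ∈ (P : Subgroup Γ), z * y = y * z := fun y hy =>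
    (congrArg Subtype.val (Subgroup.mem_center_iff.mp hzc ⟨y, hy⟩)).symm
  have hcomm_of_conj : ∀ x g : Γ, g * x * g⁻¹ = x → x * g = g * x := fun x g h => by
    nth_rewrite 1 [← h]; group
  -- If `g` normalizes `P`, the conjugate of the central `z` by `g` commutes with `z`, hence equals
  -- `z`; so `g` and `P` lie in the abelian centralizer of `z`. This is the hypothesis of Burnside's
  -- transfer theorem.
  have hP : Subgroup.normalizer P ≤ Subgroup.centralizer (P : Set Γ) := by
    intro g hg y hy
    have h1 := hn z g hz1 (hzcomm _ ((Subgroup.mem_normalizer_iff.mp hg z).mp hzP))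
    exact hc z y g hz1 (hzcomm y hy) (hcomm_of_conj _ _ h1)
  set K := (MonoidHom.transferSylow P hP).ker with hK
  have hKcard : Nat.card K < n := by
    rw [← hcard]
    refine lt_of_le_of_ne (Subgroup.card_le_card_group K) fun h => ?_
    exact MonoidHom.not_dvd_card_ker_transferSylow P hP (h ▸ Nat.minFac_dvd _)
  -- If the kernel is trivial, the group embeds in the abelian `P`. Otherwise the kernel is abelian
  -- by induction, so a nontrivial `k` in it commutes with its conjugates and is therefore central.
  by_cases hKbot : K = ⊥
  · apply (MonoidHom.ker_eq_bot_iff _).mp hKbot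
    rw [map_mul, map_mul]
    exact Subtype.ext (hc z _ _ hz1 (hzcomm _ (SetLike.coe_mem _)) (hzcomm _ (SetLike.coe_mem _)))
  · obtain ⟨k, hkK, hk1⟩ := K.bot_or_exists_ne_one.resolve_left hKbot
    have hKc := ih _ hKcard (Γ := K) rfl
      (fun x y z hx hy hz => Subtype.ext (hc x y z (fun h => hx (Subtype.ext h))
        (congrArg Subtype.val hy) (congrArg Subtype.val hz)))
      (fun x g hx h => Subtype.ext (hn x g (fun h => hx (Subtype.ext h))
        (congrArg Subtype.val h)))
    have hall : ∀ g : Γ, k * g = g * k := fun g => by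
      have hgK : g * k * g⁻¹ ∈ K := (MonoidHom.normal_ker _).conj_mem k hkK g
      exact hcomm_of_conj _ _ (hn k g hk1 (congrArg Subtype.val (hKc ⟨k, hkK⟩ ⟨_, hgK⟩)))
    exact hc k a b hk1 (hall a) (hall b)

namespace SL2

variable {F : Type*} [Field F] [CharP F 2]

/-- A subgroup of `SL(2, F)` without involutions is abelian. -/
theorem mul_comm_of_no_involution [Finite F] {H : Subgroup SL(2, F)}
    (hH : ∀ g ∈ H, g * g = 1 → g = 1) {a b : SL(2, F)} (ha : a ∈ H) (hb : b ∈ H) :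
    a * b = b * a := by
  refine congrArg Subtype.val (mul_comm_of_centralizers_abelian _ (Γ := H) rfl ?_ ?_
    ⟨a, ha⟩ ⟨b, hb⟩)
  · exact fun x y z hx hy hz => Subtype.ext (commute_of_commute (fun h => hx (Subtype.ext h))
      (congrArg Subtype.val hy) (congrArg Subtype.val hz))
  · intro x g hx h
    have hx1 : x.1 ≠ 1 := fun h => hx (Subtype.ext h)
    have hx0 : x.1 0 0 ≠ x.1 1 1 := fun h => hx1 (hH x x.2 (mul_self_eq_one_iff.mpr h))
    rcases conj_eq_or_of_commute hx0 (congrArg Subtype.val h) with h' | ⟨-, h'⟩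
    · exact Subtype.ext h'
    · have : g = 1 := Subtype.ext (hH g g.2 (mul_self_eq_one_iff.mpr h'))
      simp [this]

end SL2

/-! ### Counting involutions by fixed point and by image of `∞`. -/

namespace SL2

variable {F : Type*} [Field F]

theorem upper_sq_mem {H : Subgroup SL(2, F)} {g : SL(2, F)} {v : F} (hv : upper v ∈ H) (hg : g ∈ H)
    (hg0 : g 1 0 = 0) : upper (g 0 0 ^ 2 * v) ∈ H := by
  have hd := det_eq g
  rw [hg0] at hd
  have : upper (g 0 0 ^ 2 * v) = g * upper v * g⁻¹ := by
    apply ext_entries <;> simp [mul_entry, hg0]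
    · linear_combination -hd
    · ring
    · linear_combination -hd
  rw [this]
  exact H.mul_mem (H.mul_mem hg hv) (H.inv_mem hg)

variable [CharP F 2]

theorem mul_self_conj_upper {j : SL(2, F)} (hj : j 0 0 = j 1 1) :
    (j * upper 1 * j : SL(2, F)) 0 0 = 1 + j 0 0 * j 1 0 ∧
      (j * upper 1 * j : SL(2, F)) 1 1 = 1 + j 0 0 * j 1 0 ∧
      (j * upper 1 * j : SL(2, F)) 1 0 = j 1 0 ^ 2 := by
  have h2 : (2 : F) = 0 := CharTwo.two_eq_zero
  have hd := det_eq j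
  rw [← hj] at hd
  refine ⟨?_, ?_, ?_⟩ <;> simp [mul_entry, ← hj]
  · linear_combination hd + (j 0 1 * j 1 0) * h2
  · linear_combination hd + (j 0 1 * j 1 0) * h2
  · linear_combination j 0 0 * j 1 0 * h2

/-- Let `H` contain the involution `upper 1`, whose centralizer in `H` has minimal order among the
involutions of `H`. For every fixed point `z ≠ ∞` of an involution of `H`, counting shows that the
involutions of `H` that map `∞` to `z` are in bijection with the involutions of `H` fixing `∞`. -/
theorem exists_involutions_of_fixed_point [Finite F] {H : Subgroup SL(2, F)} (h1 : upper 1 ∈ H)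
    (hmin : ∀ j ∈ H, j 0 0 = j 1 1 → j ≠ 1 →
      {v : F | upper v ∈ H}.ncard ≤ {g : SL(2, F) | g ∈ H ∧ g * j = j * g}.ncard)
    {t : SL(2, F)} (htH : t ∈ H) (ht : t 0 0 = t 1 1) (ht0 : t 1 0 ≠ 0) :
    ∃ i ∈ H, i 0 0 = i 1 1 ∧ i 1 0 ≠ 0 ∧ i 0 0 / i 1 0 = (t 0 0 + 1) / t 1 0 ∧
      ∀ v : F, upper v ∈ H → v ≠ 0 → ∃ j ∈ H, j 0 0 = j 1 1 ∧ j 1 0 ≠ 0 ∧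
        j 0 0 / j 1 0 = (t 0 0 + 1) / t 1 0 ∧ (j 1 0 / i 1 0) ^ 2 = v := by
  classical
  have h2 : (2 : F) = 0 := CharTwo.two_eq_zero
  let _ : Fintype F := Fintype.ofFinite F
  -- `V` and `X` stand for the involutions of `H` that fix, respectively move, `∞`. For `j ∈ X`,
  -- `fixed j` is its unique fixed point and `image j` is `j(∞)`.
  let V : Finset F := Finset.univ.filter fun v => upper v ∈ H ∧ v ≠ 0
  let X : Finset SL(2, F) := Finset.univ.filter fun j => j ∈ H ∧ j 0 0 = j 1 1 ∧ j 1 0 ≠ 0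
  let fixed : SL(2, F) → F := fun j => (j 0 0 + 1) / j 1 0
  let image : SL(2, F) → F := fun j => j 0 0 / j 1 0
  let Δ : Finset F := X.image fixed
  have memX : ∀ j, j ∈ X ↔ j ∈ H ∧ j 0 0 = j 1 1 ∧ j 1 0 ≠ 0 := fun j => by simp [X]
  have memV : ∀ v, v ∈ V ↔ upper v ∈ H ∧ v ≠ 0 := fun v => by simp [V]
  have hVcard : {v : F | upper v ∈ H}.ncard = V.card + 1 := by
    have h0 : (0 : F) ∉ V := by simp [V]
    rw [← Finset.card_insert_of_notMem h0, ← Set.ncard_coe_finset]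
    congr 1
    ext v
    by_cases hv : v = 0
    · simp [hv, upper_zero, H.one_mem]
    · simp [hv, V]
  -- A nontrivial element commuting with `j` has the form `1 + β (1 + j)`, an involution with the
  -- fixed point of `j`; minimality supplies enough of them.
  have hfix : ∀ z ∈ Δ, V.card ≤ (X.filter fun j => fixed j = z).card := by
    intro z hz
    obtain ⟨j, hj, rfl⟩ := Finset.mem_image.mp hz
    obtain ⟨hjH, hj, hj0⟩ := (memX j).mp hj
    have hj1 : j ≠ 1 := fun h => hj0 (by rw [h]; rfl)
    have hle := hmin j hjH hj hj1
    let C : Finset SL(2, F) := Finset.univ.filter fun g => (g ∈ H ∧ g * j = j * g) ∧ g ≠ 1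
    have hC : {g : SL(2, F) | g ∈ H ∧ g * j = j * g}.ncard = C.card + 1 := by
      have h0 : (1 : SL(2, F)) ∉ C := by simp [C]
      rw [← Finset.card_insert_of_notMem h0, ← Set.ncard_coe_finset]
      congr 1
      ext v
      by_cases hv : v = 1
      · simp [hv, H.one_mem]
      · simp [hv, C]
    have hCX : C ⊆ X.filter fun i => fixed i = fixed j := by
      intro g hg
      obtain ⟨⟨hgH, hgj⟩, hg1⟩ := (Finset.mem_filter.mp hg).2
      obtain ⟨α, β, a1, a2, a3, a4⟩ := exists_of_commute hj1 hgj.symm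
      have hgd := det_eq g
      have hjd := det_eq j
      rw [a1, a2, a3, a4] at hgd
      rw [← hj] at hgd hjd
      have hβ : β ≠ 0 := fun h0 => hg1 (by
        have : α = 1 := sq_inj (by rw [h0] at hgd; linear_combination hgd)
        simp only [h0, this, zero_mul, add_zero] at a1 a2 a3 a4
        exact ext_entries a1 a2 a3 a4)
      have hα : α = 1 + β := sq_inj (by
        linear_combination hgd - β ^ 2 * hjd - (α * β * j 0 0 + β + β ^ 2) * h2)
      refine Finset.mem_filter.mpr ⟨(memX g).mpr ⟨hgH, by rw [a1, a4, hj], ?_⟩, ?_⟩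
      · rw [a3]; exact mul_ne_zero hβ hj0
      · simp only [fixed, a1, a3, hα]
        field_simp
        linear_combination h2
    have := Finset.card_le_card hCX
    omega
  -- The conjugate `j * upper 1 * j` is an involution fixing `j(∞)`.
  have himage : ∀ j ∈ X, image j ∈ Δ := by
    intro j hj
    obtain ⟨hjH, hj, hj0⟩ := (memX j).mp hj
    obtain ⟨e1, e2, e3⟩ := mul_self_conj_upper hj
    refine Finset.mem_image.mpr ⟨j * upper 1 * j, (memX _).mpr
      ⟨H.mul_mem (H.mul_mem hjH h1) hjH, e1.trans e2.symm, e3 ▸ pow_ne_zero 2 hj0⟩, ?_⟩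
    simp only [fixed, image, e1, e3]
    field_simp
    linear_combination h2
  -- If `i(∞) = j(∞)`, then `i * j` fixes `∞` with upper left entry `j 1 0 / i 1 0`, so it
  -- conjugates `upper 1` to the `upper` of the square.
  have hmul : ∀ i ∈ X, ∀ j ∈ X, image i = image j → (j 1 0 / i 1 0) ^ 2 ∈ V := by
    intro i hi j hj hij
    obtain ⟨hiH, hi, hi0⟩ := (memX i).mp hi
    obtain ⟨hjH, hj, hj0⟩ := (memX j).mp hj
    have hid := det_eq i
    have hjd := det_eq j
    rw [← hi] at hid
    rw [← hj] at hjd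
    have hij' : i 0 0 * j 1 0 = j 0 0 * i 1 0 := by
      simpa only [image, div_eq_div_iff hi0 hj0] using hij
    have e10 : (i * j) 1 0 = 0 := by
      simp only [mul_entry, ← hi]
      linear_combination hij' + (j 0 0 * i 1 0) * h2
    have e00 : (i * j) 0 0 = j 1 0 / i 1 0 := by
      simp only [mul_entry]
      field_simp
      linear_combination -i 0 0 * hij' - j 1 0 * hid + (i 0 0 ^ 2 * j 1 0 - j 1 0) * h2
    have := upper_sq_mem h1 (H.mul_mem hiH hjH) e10
    rw [e00, mul_one] at this
    exact (memV _).mpr ⟨this, pow_ne_zero 2 (div_ne_zero hj0 hi0)⟩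
  have hinj : ∀ i ∈ X, ∀ z, Set.InjOn (fun j : SL(2, F) => (j 1 0 / i 1 0) ^ 2)
      (X.filter fun j => image j = z) := by
    intro i hi z j hj k hk hjk
    obtain ⟨hj, hjz⟩ := Finset.mem_filter.mp hj
    obtain ⟨hk, hkz⟩ := Finset.mem_filter.mp hk
    obtain ⟨-, hi, hi0⟩ := (memX i).mp hi
    obtain ⟨-, hj, hj0⟩ := (memX j).mp hj
    obtain ⟨-, hk, hk0⟩ := (memX k).mp hk
    have e10 : j 1 0 = k 1 0 := by
      have := sq_inj hjk
      field_simp at this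
      exact this
    have e00 : j 0 0 = k 0 0 := by
      rw [← hkz] at hjz
      simp only [image, e10] at hjz
      field_simp at hjz
      exact hjz
    have hjd := det_eq j
    have hkd := det_eq k
    rw [← hj, e00, e10] at hjd
    rw [← hk] at hkd
    exact ext_entries e00 (mul_right_cancel₀ hk0 (by linear_combination hkd - hjd)) e10
      (by rw [← hj, ← hk, e00])
  have hle : ∀ z ∈ Δ, (X.filter fun j => image j = z).card ≤ V.card := by
    intro z _
    rcases (X.filter fun j => image j = z).eq_empty_or_nonempty with h | ⟨i, hi⟩
    · rw [h]; simp
    · obtain ⟨hi, hiz⟩ := Finset.mem_filter.mp hi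
      refine Finset.card_le_card_of_injOn _ (fun j hj => ?_) (hinj i hi z)
      obtain ⟨hj, hjz⟩ := Finset.mem_filter.mp hj
      exact hmul i hi j hj (hiz.trans hjz.symm)
  -- Both families of fibers over `Δ` partition `X`. Those of `fixed` have size at least `|V|`,
  -- those of `image` at most `|V|`, so equality holds throughout.
  have heq : ∀ z ∈ Δ, V.card ≤ (X.filter fun j => image j = z).card := by
    intro z hz
    by_contra! hlt
    have c1 := Finset.card_eq_sum_card_fiberwise (f := fixed) (s := X) (t := Δ)
      fun j hj => Finset.mem_image_of_mem _ hj
    have c2 := Finset.card_eq_sum_card_fiberwise (f := image) (s := X) (t := Δ) himage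
    have c3 := Finset.sum_lt_sum hle ⟨z, hz, hlt⟩
    have c4 := Finset.sum_le_sum hfix
    omega
  have htX : t ∈ X := (memX t).mpr ⟨htH, ht, ht0⟩
  have hzΔ : fixed t ∈ Δ := Finset.mem_image_of_mem _ htX
  have hVpos : 0 < V.card := Finset.card_pos.mpr ⟨1, (memV 1).mpr ⟨h1, one_ne_zero⟩⟩
  obtain ⟨i, hi⟩ := Finset.card_pos.mp (hVpos.trans_le (heq _ hzΔ))
  obtain ⟨hi, hiz⟩ := Finset.mem_filter.mp hi
  obtain ⟨hiH, hi', hi0⟩ := (memX i).mp hi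
  refine ⟨i, hiH, hi', hi0, hiz, fun v hv hv0 => ?_⟩
  have himg : (X.filter fun j => image j = fixed t).image
      (fun j : SL(2, F) => (j 1 0 / i 1 0) ^ 2) = V := by
    refine Finset.eq_of_subset_of_card_le (fun w hw => ?_) ?_
    · obtain ⟨j, hj, rfl⟩ := Finset.mem_image.mp hw
      obtain ⟨hj, hjz⟩ := Finset.mem_filter.mp hj
      exact hmul i hi j hj (hiz.trans hjz.symm)
    · rw [Finset.card_image_of_injOn (hinj i hi _)]
      exact heq _ hzΔ
  have hvV : v ∈ V := (memV v).mpr ⟨hv, hv0⟩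
  rw [← himg] at hvV
  obtain ⟨j, hj, hjv⟩ := Finset.mem_image.mp hvV
  obtain ⟨hj, hjz⟩ := Finset.mem_filter.mp hj
  obtain ⟨hjH, hj', hj0⟩ := (memX j).mp hj
  exact ⟨j, hjH, hj', hj0, hjz, hjv⟩

end SL2

/-! ### The dichotomy: dihedral type or a subfield. -/

namespace SL2

variable {F : Type*} [Field F]

theorem commute_upper_one_of_lower_left {g : SL(2, F)} (h10 : g 1 0 = 0) (h : g 0 0 = g 1 1) :
    g * upper 1 = upper 1 * g := by
  apply ext_entries <;> simp [mul_entry, h10, h, add_comm]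

theorem conj_upper_one_10 (g : SL(2, F)) :
    (g * upper 1 * g⁻¹ : SL(2, F)) 1 0 = -(g 1 0 ^ 2) := by
  simp [mul_entry]; ring

theorem eq_upper_of_entries {g : SL(2, F)} (h10 : g 1 0 = 0) (h : g 0 0 = 1) :
    g = upper (g 0 1) := by
  have hd := det_eq g
  rw [h10, h] at hd
  exact ext_entries h rfl h10 (by simpa using hd)

theorem lower_left_eq_zero_of_commute_upper_one {g : SL(2, F)} (h : g * upper 1 = upper 1 * g) :
    g 1 0 = 0 := by
  have := congrArg (fun g : SL(2, F) => g 0 0) h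
  simpa [mul_entry] using this

variable [CharP F 2]

theorem entry_eq_one {g : SL(2, F)} (h10 : g 1 0 = 0) (h : g 0 0 = g 1 1) : g 0 0 = 1 := by
  have hd := det_eq g
  rw [h10, ← h] at hd
  exact sq_inj (by linear_combination hd)

theorem upper_one_mul_self : upper (1 : F) * upper 1 = 1 := mul_self_eq_one_iff.mpr rfl

/-- A conjugate of `upper 1` by an element moving `∞` fixes the image of `∞`. -/
theorem conj_upper_one_fixed {g : SL(2, F)} (h10 : g 1 0 ≠ 0) :
    (g * upper 1 * g⁻¹ : SL(2, F)) 0 0 = (g * upper 1 * g⁻¹ : SL(2, F)) 1 1 ∧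
      (g * upper 1 * g⁻¹ : SL(2, F)) 1 0 ≠ 0 ∧
      ((g * upper 1 * g⁻¹ : SL(2, F)) 0 0 + 1) / (g * upper 1 * g⁻¹ : SL(2, F)) 1 0 =
        g 0 0 / g 1 0 := by
  have h2 : (2 : F) = 0 := CharTwo.two_eq_zero
  have hd := det_eq g
  have e00 : (g * upper 1 * g⁻¹ : SL(2, F)) 0 0 = 1 - g 0 0 * g 1 0 := by
    simp [mul_entry]; linear_combination hd
  have e11 : (g * upper 1 * g⁻¹ : SL(2, F)) 1 1 = 1 + g 0 0 * g 1 0 := by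
    simp [mul_entry]; linear_combination hd
  refine ⟨?_, ?_, ?_⟩
  · rw [e00, e11]; linear_combination -(g 0 0 * g 1 0) * h2
  · rw [conj_upper_one_10]; simpa using h10
  · rw [conj_upper_one_10, e00]
    field_simp
    linear_combination -h2

section Dichotomy

variable [Finite F] {H : Subgroup SL(2, F)} (h1 : upper 1 ∈ H)
  (hmin : ∀ j ∈ H, j 0 0 = j 1 1 → j ≠ 1 →
      {v : F | upper v ∈ H}.ncard ≤ {g : SL(2, F) | g ∈ H ∧ g * j = j * g}.ncard)

include h1 hmin

/-- If the Sylow 2-subgroups of `H` have order two and `H` has at least two involutions, then `H`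
is of dihedral type. -/
theorem le_dihedralNormalizer {c : F} (hc : c ≠ 0) (ht : lower c ∈ H)
    (hV : ∀ v : F, upper v ∈ H → v = 0 ∨ v = 1) :
    H ≤ dihedralNormalizer (upper 1 * lower c) := by
  have hs := upper_one_mul_self (F := F)
  set s : SL(2, F) := upper 1 with hsdef
  have hB : ∀ g ∈ H, g 1 0 = 0 → g = 1 ∨ g = s := by
    intro g hg h10
    have h := upper_sq_mem h1 hg h10
    have hd := det_eq g
    rw [h10] at hd
    have h00 : g 0 0 ≠ 0 := fun h0 => by simp [h0] at hd
    have h00' : g 0 0 = 1 := by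
      rcases hV _ h with h0 | h0
      · exact absurd (by simpa using h0) h00
      · exact sq_inj (by linear_combination h0)
    have hg' := eq_upper_of_entries h10 h00'
    rcases hV (g 0 1) (hg' ▸ hg) with h0 | h0
    · exact .inl (by rw [hg', h0, upper_zero])
    · exact .inr (by rw [hg', h0])
  -- The counting gives an involution `i ∈ H` with `i(∞) = g(∞)`. Then `g⁻¹ * i` fixes `∞`, so it is
  -- `1` or `s`; since `g` is not an involution, `i = g * s`.
  have hNs : ∀ g ∈ H, g * g ≠ 1 → g * s * (g * s) = 1 := by
    intro g hg hgg
    have h10 : g 1 0 ≠ 0 := fun h10 => hgg (by rcases hB g hg h10 with h | h <;> simp [h, hs])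
    obtain ⟨a1, a2, a3⟩ := conj_upper_one_fixed h10
    obtain ⟨i, hiH, hi, hi0, hiz, -⟩ := exists_involutions_of_fixed_point h1 hmin
      (H.mul_mem (H.mul_mem hg h1) (H.inv_mem hg)) a1 a2
    rw [a3, div_eq_div_iff hi0 h10] at hiz
    have hgi : (g⁻¹ * i) 1 0 = 0 := by
      simp [mul_entry]; linear_combination -hiz
    have hii := mul_self_eq_one_iff.mpr hi
    rcases hB _ (H.mul_mem (H.inv_mem hg) hiH) hgi with h | h
    · rw [inv_mul_eq_one] at h
      exact absurd (h ▸ hii) hgg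
    · rw [inv_mul_eq_iff_eq_mul] at h
      rw [← h, hii]
  -- If `y` moves `∞`, an involution of `H` taking `∞` to the fixed point of `y` conjugates `y` to
  -- `s`.
  have hC : ∀ y ∈ H, y * y = 1 → y ≠ 1 → ∀ g ∈ H, g * y = y * g → g = 1 ∨ g = y := by
    intro y hy hyy hy1 g hg hgy
    by_cases h10 : y 1 0 = 0
    · obtain rfl := (hB y hy h10).resolve_left hy1
      exact hB g hg (lower_left_eq_zero_of_commute_upper_one hgy)
    · have hy' := mul_self_eq_one_iff.mp hyy
      obtain ⟨i, hiH, hi, hi0, hiz, -⟩ := exists_involutions_of_fixed_point h1 hmin hy hy' h10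
      have h2 : (2 : F) = 0 := CharTwo.two_eq_zero
      have hyd := det_eq y
      rw [← hy'] at hyd
      rw [div_eq_div_iff hi0 h10] at hiz
      have hiyi : (i⁻¹ * y * i) 1 0 = 0 := by
        have : y 1 0 * (i⁻¹ * y * i) 1 0 = 0 := by
          simp only [mul_entry, inv_10, inv_11, ← hy']
          linear_combination (i 0 0 * y 1 0 + y 0 0 * i 1 0 + i 1 0) * hiz +
            i 1 0 ^ 2 * hyd + (i 1 0 ^ 2 * (y 0 0 + 1)) * h2
        exact (mul_eq_zero.mp this).resolve_left h10
      have hiys : i⁻¹ * y * i = s := by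
        refine (hB _ (H.mul_mem (H.mul_mem (H.inv_mem hiH) hy) hiH) hiyi).resolve_left
          fun h => hy1 ?_
        calc y = i * (i⁻¹ * y * i) * i⁻¹ := by group
          _ = 1 := by rw [h]; group
      have hgs : (i⁻¹ * g * i) * s = s * (i⁻¹ * g * i) := by
        rw [← hiys]
        calc i⁻¹ * g * i * (i⁻¹ * y * i) = i⁻¹ * (g * y) * i := by group
          _ = _ := by rw [hgy]; group
      have hg' : g = i * (i⁻¹ * g * i) * i⁻¹ := by group
      rcases hB _ (H.mul_mem (H.mul_mem (H.inv_mem hiH) hg) hiH)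
        (lower_left_eq_zero_of_commute_upper_one hgs) with h | h
      · left; rw [hg', h]; group
      · right; rw [hg', h, ← hiys]; group
  -- Involutions invert non-involutions: otherwise `g * s` and `y * g * s` both square to one, so `g
  -- * s` commutes with `y`, and `hC` makes `g` or `y * g` equal to `s`.
  have hinv : ∀ y ∈ H, y * y = 1 → y ≠ 1 → ∀ g ∈ H, g * g ≠ 1 → y * g * (y * g) = 1 := by
    intro y hy hyy hy1 g hg hgg
    by_contra hyg
    have e1 := hNs g hg hgg
    have e2 := hNs (y * g) (H.mul_mem hy hg) hyg
    have e3 : g * s * y = y * (g * s) := by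
      have := inv_eq_of_mul_eq_one_left e2
      rw [mul_assoc y g s, mul_inv_rev, inv_eq_of_mul_eq_one_left e1,
        inv_eq_of_mul_eq_one_left hyy] at this
      exact this
    rcases hC y hy hyy hy1 (g * s) (H.mul_mem hg h1) e3 with h | h
    · have : g = s := by rw [eq_inv_of_mul_eq_one_left h, inv_eq_of_mul_eq_one_left hs]
      exact hgg (this ▸ hs)
    · have : y * g = s := by
        have hgy : g = y * s := by rw [← h, mul_assoc, hs, mul_one]
        rw [hgy, ← mul_assoc, hyy, one_mul]
      exact hyg (this ▸ hs)
  set x := s * lower c with hx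
  have hxH : x ∈ H := H.mul_mem h1 ht
  have hxx : x * x ≠ 1 := fun h => by
    have := mul_self_eq_one_iff.mp h
    simp [hx, hsdef, mul_entry, hc] at this
  have hs1 : s ≠ 1 := fun h => by
    have := congrArg (fun g : SL(2, F) => g 0 1) h
    simp [hsdef] at this
  clear_value x
  intro g hg
  by_cases hgg : g * g = 1
  · by_cases hg1 : g = 1
    · rw [hg1]; exact Subgroup.one_mem _
    · right
      rw [inv_eq_of_mul_eq_one_left hgg, eq_inv_iff_mul_eq_one]
      simpa only [mul_assoc] using hinv g hg hgg hg1 x hxH hxx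
  -- Both `s` and `x * s` are involutions inverting `g`, so their product centralizes it, and with
  -- it `x`.
  · have hw := hNs x hxH hxx
    have hw1 : x * s ≠ 1 := fun h => hxx (by
      have : x = s := by rw [eq_inv_of_mul_eq_one_left h, inv_eq_of_mul_eq_one_left hs]
      rw [this, hs])
    have e1 := hinv _ (H.mul_mem hxH h1) hw hw1 g hg hgg
    have e2 := hinv s h1 hs hs1 g hg hgg
    left
    have h6 : x * s * g * (x * s) = g⁻¹ := by
      rw [eq_inv_iff_mul_eq_one]; simpa only [mul_assoc] using e1
    have h7 : x * s * g = g⁻¹ * (x * s) := by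
      rw [← h6, mul_assoc _ (x * s), hw, mul_one]
    have h8 : s * g = g⁻¹ * s := by
      rw [← mul_inv_eq_iff_eq_mul, inv_eq_of_mul_eq_one_left hs, eq_inv_iff_mul_eq_one]
      simpa only [mul_assoc] using e2
    have h9 : x * g⁻¹ * s = g⁻¹ * x * s := by
      rw [mul_assoc, ← h8, ← mul_assoc, h7, ← mul_assoc]
    have h10 := mul_right_cancel h9
    rw [eq_inv_mul_iff_mul_eq, ← mul_assoc, mul_inv_eq_iff_eq_mul] at h10
    rw [h10, mul_inv_cancel_right]

/-- If the Sylow 2-subgroups of `H` have order at least four and `H` is not contained in a Borel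
subgroup, then `H` is defined over a subfield, and contains all matrices over that subfield. -/
theorem exists_subfield {c : F} (hc : c ≠ 0) (ht : lower c ∈ H) {v₀ : F}
    (hv₀ : upper v₀ ∈ H) (hv₀0 : v₀ ≠ 0) (hv₀1 : v₀ ≠ 1) :
    ∃ K : Subfield F, (∀ h ∈ H, ∀ i j, h i j ∈ K) ∧ (K = ⊤ → H = ⊤) := by
  have h2 : (2 : F) = 0 := CharTwo.two_eq_zero
  have key := fun {t : SL(2, F)} => exists_involutions_of_fixed_point (t := t) h1 hmin
  -- The fixed point of `lower c` is `0`, so `i` exchanges `∞` and `0`. Products of such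
  -- antidiagonal involutions are the diagonal elements that make the translations of `H` closed
  -- under multiplication and inversion.
  obtain ⟨i, hiH, hi, hi0, hiz, hij⟩ := key ht rfl hc
  have hi00 : i 0 0 = 0 := by
    have : (1 : F) + 1 = 0 := by linear_combination h2
    simpa [this, hi0] using hiz
  have hid := det_eq i
  rw [← hi, hi00] at hid
  have hdiag : ∀ v, upper v ∈ H → v ≠ 0 → ∃ (a : F) (ha : a ≠ 0), a ^ 2 = v ∧ diag a ha ∈ H := by
    intro v hv hv0
    obtain ⟨j, hjH, hj, hj0, hjz, hjv⟩ := hij v hv hv0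
    have hj00 : j 0 0 = 0 := by
      have : (1 : F) + 1 = 0 := by linear_combination h2
      simpa [this, hj0] using hjz
    have hjd := det_eq j
    rw [← hj, hj00] at hjd
    refine ⟨j 1 0 / i 1 0, div_ne_zero hj0 hi0, hjv, ?_⟩
    have : diag (j 1 0 / i 1 0) (div_ne_zero hj0 hi0) = i * j := by
      apply ext_entries <;> simp [mul_entry, ← hi, ← hj, hi00, hj00] <;> field_simp
      · linear_combination hid + h2
      · linear_combination hjd + h2
    rw [this]
    exact H.mul_mem hiH hjH
  have hmul : ∀ v w, upper v ∈ H → upper w ∈ H → upper (v * w) ∈ H := by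
    intro v w hv hw
    by_cases hv0 : v = 0
    · rw [hv0, zero_mul, upper_zero]; exact H.one_mem
    · obtain ⟨a, ha, rfl, haH⟩ := hdiag v hv hv0
      have := upper_sq_mem hw haH (diag_10 a ha)
      rwa [diag_00] at this
  have hinv : ∀ v, upper v ∈ H → upper v⁻¹ ∈ H := by
    intro v hv
    by_cases hv0 : v = 0
    · rw [hv0, inv_zero, upper_zero]; exact H.one_mem
    · obtain ⟨a, ha, rfl, haH⟩ := hdiag v hv hv0
      have := upper_sq_mem h1 (H.inv_mem haH) (by rw [inv_10, diag_10, neg_zero])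
      rwa [inv_00, diag_11, mul_one, inv_pow] at this
  have hadd : ∀ v w, upper v ∈ H → upper w ∈ H → upper (v + w) ∈ H := fun v w hv hw => by
    rw [← upper_mul_upper]; exact H.mul_mem hv hw
  have hneg : ∀ v, upper v ∈ H → upper (-v) ∈ H := fun v hv => by
    rw [← upper_inv]; exact H.inv_mem hv
  obtain ⟨K, memK⟩ : ∃ K : Subfield F, ∀ v, v ∈ K ↔ upper v ∈ H :=
    ⟨{  carrier := {v | upper v ∈ H}
        zero_mem' := by rw [Set.mem_ofPred_eq, upper_zero]; exact H.one_mem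
        one_mem' := h1
        add_mem' := fun {v w} => hadd v w
        neg_mem' := fun {v} => hneg v
        mul_mem' := fun {v w} => hmul v w
        inv_mem' := hinv }, fun v => Iff.rfl⟩
  -- Since `|F|` is even, `a = (a²)^(|F| / 2)`.
  have hsq : ∀ a : F, a ^ 2 ∈ K → a ∈ K := by
    intro a ha
    let _ : Fintype F := Fintype.ofFinite F
    have hF : Fintype.card F % 2 = 0 :=
      FiniteField.even_card_iff_char_two.mp (ringChar.eq F 2 |>.symm ▸ rfl)
    have := K.pow_mem ha (Fintype.card F / 2)
    rwa [← pow_mul, Nat.mul_div_cancel' (Nat.dvd_of_mod_eq_zero hF), FiniteField.pow_card] at this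
  have hB : ∀ g ∈ H, g 1 0 = 0 → g 0 0 ∈ K ∧ g 0 1 ∈ K ∧ g 1 1 ∈ K := by
    intro g hg h10
    have hd := det_eq g
    rw [h10, mul_zero, sub_zero] at hd
    have h00 : g 0 0 ≠ 0 := left_ne_zero_of_mul_eq_one hd
    have h := upper_sq_mem h1 hg h10
    rw [mul_one] at h
    have h00K := hsq _ ((memK _).mpr h)
    obtain ⟨a, ha, ha2, haH⟩ := hdiag _ h (pow_ne_zero 2 h00)
    obtain rfl := sq_inj ha2
    have hu : (diag (g 0 0) ha)⁻¹ * g = upper ((g 0 0)⁻¹ * g 0 1) := by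
      apply ext_entries <;> simp [mul_entry, h10]
      · exact inv_mul_cancel₀ ha
      · exact hd
    have h01 : (g 0 0)⁻¹ * g 0 1 ∈ K := (memK _).mpr (hu ▸ H.mul_mem (H.inv_mem haH) hg)
    refine ⟨h00K, ?_, ?_⟩
    · have := K.mul_mem h00K h01
      rwa [mul_inv_cancel_left₀ ha] at this
    · rw [eq_inv_of_mul_eq_one_right hd]; exact K.inv_mem h00K
  have hfix : ∀ y ∈ H, y 0 0 = y 1 1 → y 1 0 ≠ 0 → (y 0 0 + 1) / y 1 0 ∈ K := by
    intro y hy hy' hy0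
    obtain ⟨i, hiH, hi, hi0, hiz, hij⟩ := key hy hy' hy0
    -- Here `i * j` fixes both `∞` and `z`; as `v₀ ≠ 1` its diagonal entries differ, so `z` solves a
    -- nondegenerate linear equation over `K`.
    obtain ⟨j, hjH, hj, hj0, hjz, hjv⟩ := hij v₀ hv₀ hv₀0
    set z := (y 0 0 + 1) / y 1 0
    rw [div_eq_iff hi0] at hiz
    rw [div_eq_iff hj0] at hjz
    have h10 : (i * j) 1 0 = 0 := by
      simp only [mul_entry, ← hi]
      linear_combination j 1 0 * hiz + i 1 0 * hjz + (z * i 1 0 * j 1 0) * h2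
    obtain ⟨k00, k01, k11⟩ := hB _ (H.mul_mem hiH hjH) h10
    have hgz : (i * j) 0 0 * z + (i * j) 0 1 = z * (i * j) 1 1 := by
      simp only [mul_entry, ← hi, ← hj]
      linear_combination j 0 1 * hiz - i 0 1 * hjz + (i 0 1 * j 0 0) * h2
    have hd := det_eq (i * j)
    rw [h10] at hd
    have hne' : (i * j) 1 1 - (i * j) 0 0 ≠ 0 := by
      intro h0
      have h00 := entry_eq_one h10 (sub_eq_zero.mp h0).symm
      have hid := det_eq i
      rw [← hi] at hid
      have e00 : (i * j) 0 0 * i 1 0 = j 1 0 := by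
        simp only [mul_entry]
        linear_combination i 0 0 * i 1 0 * hjz - i 0 0 * j 1 0 * hiz - j 1 0 * hid +
          (i 0 0 ^ 2 * j 1 0 - j 1 0) * h2
      rw [h00, one_mul] at e00
      rw [e00, div_self hj0] at hjv
      exact hv₀1 (by rw [← hjv, one_pow])
    have : z = (i * j) 0 1 / ((i * j) 1 1 - (i * j) 0 0) := by
      rw [eq_div_iff hne']; linear_combination -hgz
    rw [this]
    exact K.div_mem k01 (K.sub_mem k11 k00)
  have hinf : ∀ g ∈ H, g 1 0 ≠ 0 → g 0 0 / g 1 0 ∈ K := by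
    intro g hg h10
    obtain ⟨a1, a2, a3⟩ := conj_upper_one_fixed h10
    exact a3 ▸ hfix _ (H.mul_mem (H.mul_mem hg h1) (H.inv_mem hg)) a1 a2
  refine ⟨K, fun g hg => ?_, fun hK => ?_⟩
  · suffices h : g 0 0 ∈ K ∧ g 0 1 ∈ K ∧ g 1 0 ∈ K ∧ g 1 1 ∈ K by
      obtain ⟨k1, k2, k3, k4⟩ := h
      intro i j
      fin_cases i <;> fin_cases j <;> assumption
    by_cases h10 : g 1 0 = 0
    · obtain ⟨k1, k2, k3⟩ := hB g hg h10
      exact ⟨k1, k2, h10 ▸ K.zero_mem, k3⟩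
    have hd := det_eq g
    have hy := hinf g hg h10
    have hy' := hinf _ (H.inv_mem hg) (by simpa using h10)
    rw [inv_00, inv_10, div_neg] at hy'
    have hy' := neg_mem_iff.mp hy'
    -- Translations by elements of `K` make `g` antidiagonal with the same lower left entry; the
    -- image of `∞` under `w * upper 1 * w` then shows that this entry is in `K`.
    let w := upper (-(g 0 0 / g 1 0)) * g * upper (-(g 1 1 / g 1 0))
    have hwH : w ∈ H := 
      H.mul_mem (H.mul_mem ((memK _).mp (K.neg_mem hy)) hg) ((memK _).mp (K.neg_mem hy'))
    have w00 : w 0 0 = 0 := by simp [w, mul_entry, h10]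
    have w10 : w 1 0 = g 1 0 := by simp [w, mul_entry]
    have w11 : w 1 1 = 0 := by simp [w, mul_entry, mul_div_cancel₀ _ h10]
    have hwd := det_eq w
    rw [w00, w10] at hwd
    have h10K : g 1 0 ∈ K := by
      have e := hinf (w * upper 1 * w) (H.mul_mem (H.mul_mem hwH h1) hwH)
        (by simp [mul_entry, w00, w10, w11, h10])
      have e' : (w * upper 1 * w : SL(2, F)) 0 0 / (w * upper 1 * w : SL(2, F)) 1 0 =
          -((g 1 0)⁻¹ ^ 2) := by
        simp [mul_entry, w00, w10, w11]
        field_simp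
        linear_combination -hwd
      rw [e', neg_mem_iff] at e
      exact inv_mem_iff.mp (hsq _ e)
    have h00K : g 0 0 ∈ K := by
      have := K.mul_mem hy h10K
      rwa [div_mul_cancel₀ _ h10] at this
    have h11K : g 1 1 ∈ K := by
      have := K.mul_mem hy' h10K
      rwa [div_mul_cancel₀ _ h10] at this
    refine ⟨h00K, ?_, h10K, h11K⟩
    have : g 0 1 = (g 0 0 * g 1 1 - 1) / g 1 0 := by
      rw [eq_div_iff h10]; linear_combination -hd
    rw [this]
    exact K.div_mem (K.sub_mem (K.mul_mem h00K h11K) K.one_mem) h10K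
  · have hu : ∀ v, upper v ∈ H := fun v => (memK v).mp (hK ▸ Subfield.mem_top v)
    refine eq_top_of_upper_of_lower hu fun v => ?_
    have : lower v = i * upper (-(v / i 1 0 ^ 2)) * i⁻¹ := by
      apply ext_entries <;> simp [mul_entry, ← hi, hi00]
      · linear_combination -hid
      · field_simp
      · linear_combination -hid
    rw [this]
    exact H.mul_mem (H.mul_mem hiH (hu _)) (H.inv_mem hiH)

end Dichotomy

end SL2

/-! ### Classification of subgroups up to conjugacy. -/

namespace SL2

variable {F : Type*} [Field F] [CharP F 2]

theorem exists_conj_eq_upper_one [Finite F] {s : SL(2, F)} (hs : s 0 0 = s 1 1) (hs1 : s ≠ 1) :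
    ∃ γ : SL(2, F), γ * s * γ⁻¹ = upper 1 := by
  have h2 : (2 : F) = 0 := CharTwo.two_eq_zero
  have hd := det_eq s
  rw [← hs] at hd
  simp only [mul_inv_eq_iff_eq_mul]
  by_cases hc : s 1 0 = 0
  · have h00 := entry_eq_one hc hs
    have hb : s 0 1 ≠ 0 := fun hb => hs1 (ext_entries h00 hb hc (hs ▸ h00))
    obtain ⟨p, hp⟩ := exists_sq_eq (s 0 1)⁻¹
    have hpb : p ^ 2 * s 0 1 = 1 := by rw [hp, inv_mul_cancel₀ hb]
    refine ⟨mk p 0 0 (p * s 0 1) (by linear_combination hpb), ?_⟩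
    apply ext_entries <;> simp [mul_entry, hc, ← hs, h00]
  · obtain ⟨k, hk⟩ := exists_sq_eq (s 1 0)⁻¹
    have hkc : k ^ 2 * s 1 0 = 1 := by rw [hk, inv_mul_cancel₀ hc]
    refine ⟨mk 0 k (s 1 0 * k) ((s 0 0 + 1) * k) (by linear_combination -hkc - h2), ?_⟩
    apply ext_entries <;> simp [mul_entry, ← hs]
    · ring
    · linear_combination -k * h2
    · linear_combination (s 1 0 * k * s 0 0) * h2
    · linear_combination (-k) * hd + k * (s 0 0 ^ 2 - 1) * h2

/-- Not commuting means having different fixed points. Once `s` is `upper 1`, a translation, which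
commutes with it, moves the fixed point of `t` to `0`. -/
theorem exists_conj_eq_upper_lower [Finite F] {s t : SL(2, F)} (hs : s 0 0 = s 1 1) (hs1 : s ≠ 1)
    (ht : t * t = 1) (hst : t * s ≠ s * t) :
    ∃ (γ : SL(2, F)) (c : F), c ≠ 0 ∧ γ * s * γ⁻¹ = upper 1 ∧ γ * t * γ⁻¹ = lower c := by
  have h2 : (2 : F) = 0 := CharTwo.two_eq_zero
  obtain ⟨γ, hγ⟩ := exists_conj_eq_upper_one hs hs1
  set t' := γ * t * γ⁻¹ with ht'
  have htt : t' 0 0 = t' 1 1 := mul_self_eq_one_iff.mp (by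
    calc t' * t' = γ * (t * t) * γ⁻¹ := by rw [ht']; group
      _ = 1 := by rw [ht]; group)
  have h10 : t' 1 0 ≠ 0 := fun h10 => hst (by
    have := commute_upper_one_of_lower_left h10 htt
    rw [← hγ, ht'] at this
    have h3 : γ * (t * s) * γ⁻¹ = γ * (s * t) * γ⁻¹ := by
      calc _ = γ * t * γ⁻¹ * (γ * s * γ⁻¹) := by group
        _ = _ := by rw [this]; group
    exact mul_left_cancel (mul_right_cancel h3))
  have hd := det_eq t'
  rw [← htt] at hd
  set z := (t' 0 0 + 1) / t' 1 0 with hz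
  have hzt : z * t' 1 0 = t' 0 0 + 1 := div_mul_cancel₀ _ h10
  refine ⟨upper z * γ, t' 1 0, h10, ?_, ?_⟩
  · calc upper z * γ * s * (upper z * γ)⁻¹ = upper z * (γ * s * γ⁻¹) * (upper z)⁻¹ := by group
      _ = upper 1 := by rw [hγ, upper_mul_upper, add_comm, ← upper_mul_upper]; group
  · calc upper z * γ * t * (upper z * γ)⁻¹ = upper z * t' * (upper z)⁻¹ := by rw [ht']; group
      _ = lower (t' 1 0) := by
        have h00 : (upper z * t' * (upper z)⁻¹ : SL(2, F)) 0 0 = 1 := by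
          simp [mul_entry]; linear_combination hzt + t' 0 0 * h2
        have h11 : (upper z * t' * (upper z)⁻¹ : SL(2, F)) 1 1 = 1 := by
          simp [mul_entry, ← htt]; linear_combination -hzt - h2
        have h10' : (upper z * t' * (upper z)⁻¹ : SL(2, F)) 1 0 = t' 1 0 := by
          simp [mul_entry]
        have hd' := det_eq (upper z * t' * (upper z)⁻¹)
        rw [h00, h11, h10'] at hd'
        exact ext_entries h00
          ((mul_eq_zero.mp (by linear_combination -hd')).resolve_right h10) h10' h11

/-- The conjugate `γ H γ⁻¹`. -/
abbrev conjBy {G : Type*} [Group G] (γ : G) (H : Subgroup G) : Subgroup G :=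
  H.map (MulAut.conj γ).toMonoidHom

theorem mem_conjBy {G : Type*} [Group G] {γ g : G} {H : Subgroup G} :
    g ∈ conjBy γ H ↔ γ⁻¹ * g * γ ∈ H := by
  rw [Subgroup.mem_map_equiv, MulAut.conj_symm_apply]

theorem conj_mem_conjBy {G : Type*} [Group G] {γ g : G} {H : Subgroup G} (hg : g ∈ H) :
    γ * g * γ⁻¹ ∈ conjBy γ H := by
  rw [mem_conjBy]; convert hg using 1; group

/-- Subgroups of `SL(2, F)` in characteristic two, up to conjugacy: the reducible ones, those of
dihedral or cyclic type, those defined over a proper subfield, and the whole group. -/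
theorem subgroup_classification [Finite F] (H : Subgroup SL(2, F)) :
    ∃ γ : SL(2, F), conjBy γ H ≤ borel F ∨
      (∃ x : SL(2, F), x 0 0 ≠ x 1 1 ∧ conjBy γ H ≤ dihedralNormalizer x ∧
        (¬ conjBy γ H ≤ Subgroup.centralizer {x} ∨
          ∀ z : F, z ^ 2 + z * (x 0 0 + x 1 1) + 1 ≠ 0)) ∨
      (∃ K : Subfield F, K ≠ ⊤ ∧ ∀ h ∈ conjBy γ H, ∀ i j, h i j ∈ K) ∨ conjBy γ H = ⊤ := by
  by_cases hodd : ∀ g ∈ H, g * g = 1 → g = 1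
  · by_cases hbot : H = ⊥
    · exact ⟨1, .inl (by rw [hbot]; simp)⟩
    obtain ⟨x, hxH, hx1⟩ := H.bot_or_exists_ne_one.resolve_left hbot
    have hx : x 0 0 ≠ x 1 1 := fun h => hx1 (hodd x hxH (mul_self_eq_one_iff.mpr h))
    have hHx : H ≤ Subgroup.centralizer {x} := fun g hg =>
      Subgroup.mem_centralizer_singleton_iff.mpr (mul_comm_of_no_involution hodd hg hxH)
    by_cases hroot : ∀ z : F, z ^ 2 + z * (x 0 0 + x 1 1) + 1 ≠ 0
    · refine ⟨1, .inr (.inl ⟨x, hx, fun g hg => ?_, .inr hroot⟩)⟩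
      rw [mem_conjBy, inv_one, one_mul, mul_one] at hg
      exact centralizer_le_dihedralNormalizer x (hHx hg)
    · push Not at hroot
      obtain ⟨z, hz⟩ := hroot
      obtain ⟨γ, hγ⟩ := exists_conj_mem_borel_of_root hx1 hz
      refine ⟨γ, .inl ?_⟩
      rintro _ ⟨g, hg, rfl⟩
      exact hγ g (hHx hg)
  push Not at hodd
  obtain ⟨s₀, hs₀H, hs₀, hs₀1⟩ := hodd
  let C : SL(2, F) → ℕ := fun s => {g : SL(2, F) | g ∈ H ∧ g * s = s * g}.ncard
  obtain ⟨s, ⟨hsH, hs, hs1⟩, hsmin⟩ := Set.exists_min_image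
    {s : SL(2, F) | s ∈ H ∧ s * s = 1 ∧ s ≠ 1} C (Set.toFinite _) ⟨s₀, hs₀H, hs₀, hs₀1⟩
  have hs' := mul_self_eq_one_iff.mp hs
  -- If all involutions commute with `s`, so do its conjugates by `H`; hence `H` preserves the fixed
  -- point of `s` and is reducible.
  by_cases hcomm : ∀ t ∈ H, t * t = 1 → t * s = s * t
  · obtain ⟨γ, hγ⟩ := exists_conj_eq_upper_one hs' hs1
    refine ⟨γ, .inl ?_⟩
    rintro _ ⟨g, hg, rfl⟩
    have h1 := hcomm (g * s * g⁻¹) (H.mul_mem (H.mul_mem hg hsH) (H.inv_mem hg)) (by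
      calc g * s * g⁻¹ * (g * s * g⁻¹) = g * (s * s) * g⁻¹ := by group
        _ = 1 := by rw [hs]; group)
    set g' := γ * g * γ⁻¹ with hg'
    have h2 : g' * upper 1 * g'⁻¹ * upper 1 = upper 1 * (g' * upper 1 * g'⁻¹) := by
      rw [← hγ, hg']
      calc _ = γ * (g * s * g⁻¹ * s) * γ⁻¹ := by group
        _ = _ := by rw [h1]; group
    have h3 := lower_left_eq_zero_of_commute_upper_one h2
    rw [conj_upper_one_10] at h3
    change g' 1 0 = 0
    simpa using h3
  push Not at hcomm
  obtain ⟨t, htH, ht, hts⟩ := hcomm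
  obtain ⟨γ, c, hc, hγs, hγt⟩ := exists_conj_eq_upper_lower hs' hs1 ht hts
  refine ⟨γ, .inr ?_⟩
  set H' := conjBy γ H with hH'
  have h1 : upper 1 ∈ H' := hγs ▸ conj_mem_conjBy hsH
  have hl : lower c ∈ H' := hγt ▸ conj_mem_conjBy htH
  have hCard : ∀ j, {g : SL(2, F) | g ∈ H' ∧ g * j = j * g}.ncard = C (γ⁻¹ * j * γ) := by
    intro j
    refine Eq.trans ?_ (Set.ncard_image_of_injective _ (MulAut.conj γ).injective)
    congr 1
    ext g
    constructor
    · rintro ⟨hg, hgj⟩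
      refine ⟨γ⁻¹ * g * γ, ⟨mem_conjBy.mp hg, ?_⟩, ?_⟩
      · calc γ⁻¹ * g * γ * (γ⁻¹ * j * γ) = γ⁻¹ * (g * j) * γ := by group
          _ = _ := by rw [hgj]; group
      · rw [MulAut.conj_apply]; group
    · rintro ⟨g, ⟨hg, hgj⟩, rfl⟩
      refine ⟨conj_mem_conjBy hg, ?_⟩
      rw [MulAut.conj_apply]
      calc γ * g * γ⁻¹ * j = γ * (g * (γ⁻¹ * j * γ)) * γ⁻¹ := by group
        _ = _ := by rw [hgj]; group
  have hVcard : {v : F | upper v ∈ H'}.ncard = C s := by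
    have : s = γ⁻¹ * upper 1 * γ := by rw [← hγs]; group
    rw [this, ← hCard, ← Set.ncard_image_of_injective _ upper_injective]
    congr 1
    ext g
    constructor
    · rintro ⟨v, hv, rfl⟩
      exact ⟨hv, by rw [upper_mul_upper, upper_mul_upper, add_comm]⟩
    · rintro ⟨hg, hgc⟩
      have h10 := lower_left_eq_zero_of_commute_upper_one hgc
      have e01 := congrArg (fun g : SL(2, F) => g 0 1) hgc
      simp [mul_entry] at e01
      have := eq_upper_of_entries h10 (entry_eq_one h10 (by linear_combination e01))
      exact ⟨g 0 1, this ▸ hg, this.symm⟩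
  have hmin : ∀ j ∈ H', j 0 0 = j 1 1 → j ≠ 1 →
      {v : F | upper v ∈ H'}.ncard ≤ {g : SL(2, F) | g ∈ H' ∧ g * j = j * g}.ncard := by
    intro j hj hjj hj1
    rw [hVcard, hCard]
    refine hsmin _ ⟨mem_conjBy.mp hj, ?_, fun h => hj1 ?_⟩
    · calc γ⁻¹ * j * γ * (γ⁻¹ * j * γ) = γ⁻¹ * (j * j) * γ := by group
        _ = 1 := by rw [mul_self_eq_one_iff.mpr hjj]; group
    · calc j = γ * (γ⁻¹ * j * γ) * γ⁻¹ := by group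
        _ = 1 := by rw [h]; group
  by_cases hV : ∀ v : F, upper v ∈ H' → v = 0 ∨ v = 1
  · left
    refine ⟨upper 1 * lower c, ?_, le_dihedralNormalizer h1 hmin hc hl hV, .inl fun h => ?_⟩
    · simpa [mul_entry] using hc
    · have := lower_left_eq_zero_of_commute_upper_one
        (Subgroup.mem_centralizer_singleton_iff.mp (h h1)).symm
      simp [mul_entry] at this
      exact hc this
  · push Not at hV
    obtain ⟨v, hv, hv0, hv1⟩ := hV
    obtain ⟨K, hK, htop⟩ := exists_subfield h1 hmin hc hl hv hv0 hv1
    by_cases hKtop : K = ⊤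
    · exact .inr (.inr (htop hKtop))
    · exact .inr (.inl ⟨K, hKtop, hK⟩)

end SL2

/-! ### Maximal subfields and the induction on `k`. -/

/-- A proper subfield of the field with `2 ^ k` elements is contained in a subfield of prime
index. -/
theorem exists_subfield_of_prime_index {F : Type*} [Field F] [Finite F] {k : ℕ}
    (hF : Nat.card F = 2 ^ k) {K : Subfield F} (hK : K ≠ ⊤) :
    ∃ (E : Subfield F) (p a : ℕ), K ≤ E ∧ E ≠ ⊤ ∧ p.Prime ∧ k = p * a ∧ Nat.card E = 2 ^ a := by
  have hcard : Nat.card Gal(F/K) = Module.finrank K F := IsGalois.card_aut_eq_finrank K F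
  have h1 : Module.finrank K F ≠ 1 := fun h => hK (by
    rw [eq_top_iff]
    intro x _
    obtain ⟨y, hy⟩ := finrank_eq_one_iff_of_nonzero' (1 : F) one_ne_zero |>.mp h x
    rw [← hy, Subfield.smul_def, smul_eq_mul, mul_one]
    exact y.2)
  have hp := Nat.minFac_prime h1
  set p := (Module.finrank K F).minFac with hpdef
  have : Fact p.Prime := ⟨hp⟩
  -- Cauchy's theorem in the Galois group: the fixed field of an element of order `p` has index `p`.
  obtain ⟨g, hg⟩ := exists_prime_orderOf_dvd_card' (G := Gal(F/K)) p (hcard ▸ Nat.minFac_dvd _)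
  let E := IntermediateField.fixedField (Subgroup.zpowers g)
  have hE : Module.finrank E F = p := by
    rw [IntermediateField.finrank_fixedField_eq_card, Nat.card_zpowers, hg]
  have hEF : Nat.card F = Nat.card E ^ p := by
    rw [← hE]; exact Module.natCard_eq_pow_finrank
  have hdvd : Nat.card E ∣ 2 ^ k := by
    rw [← hF, hEF]; exact dvd_pow_self _ hp.ne_zero
  obtain ⟨a, -, ha⟩ := (Nat.dvd_prime_pow Nat.prime_two).mp hdvd
  refine ⟨E.toSubfield, p, a, fun x hx => E.algebraMap_mem ⟨x, hx⟩, fun htop => ?_, hp, ?_, ha⟩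
  · have hEtop : E = ⊤ := IntermediateField.toSubfield_injective htop
    rw [hEtop, IntermediateField.finrank_top] at hE
    exact hp.one_lt.ne hE
  · rw [hF, ha, ← pow_mul] at hEF
    rw [Nat.pow_right_injective le_rfl hEF, mul_comm]

namespace SL2

open ArithmeticFunction

variable {F : Type*} [Field F]

theorem map_subtype_injective (E : Subfield F) :
    Function.Injective (Matrix.SpecialLinearGroup.map (n := Fin 2) E.subtype) := by
  intro g h hgh
  ext i j
  exact congrArg (fun g : SL(2, F) => g i j) hgh

theorem mem_range_map_subtype {E : Subfield F} {g : SL(2, F)} :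
    g ∈ (Matrix.SpecialLinearGroup.map (n := Fin 2) E.subtype).range ↔ ∀ i j, g i j ∈ E := by
  constructor
  · rintro ⟨g, rfl⟩ i j
    exact (g i j).2
  · intro h
    refine ⟨mk ⟨g 0 0, h 0 0⟩ ⟨g 0 1, h 0 1⟩ ⟨g 1 0, h 1 0⟩ ⟨g 1 1, h 1 1⟩
      (Subtype.ext (det_eq g)), ?_⟩
    apply ext_entries <;> rfl

theorem range_map_subtype_ne_top {E : Subfield F} (hE : E ≠ ⊤) :
    (Matrix.SpecialLinearGroup.map (n := Fin 2) E.subtype).range ≠ ⊤ := fun h => hE (by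
  rw [eq_top_iff]
  intro v _
  have : upper v ∈ (Matrix.SpecialLinearGroup.map (n := Fin 2) E.subtype).range :=
    h ▸ Subgroup.mem_top _
  exact mem_range_map_subtype.mp this 0 1)

theorem not_bot_covBy_top : ¬ (⊥ : Subgroup SL(2, F)) ⋖ ⊤ := by
  intro h
  have hu : upper (1 : F) ≠ 1 := fun h => by
    have := congrArg (fun g : SL(2, F) => g 0 1) h
    simp at this
  rcases h.eq_or_eq (c := Subgroup.zpowers (upper 1)) bot_le le_top with h' | h'
  · exact hu (Subgroup.zpowers_eq_bot.mp h')
  · obtain ⟨n, hn⟩ := Subgroup.mem_zpowers_iff.mp (h' ▸ Subgroup.mem_top (lower (1 : F)))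
    have hle : Subgroup.zpowers (upper (1 : F)) ≤ borel F := by
      rw [Subgroup.zpowers_le]; rfl
    exact borel_ne_top (top_le_iff.mp (h' ▸ hle))

variable [CharP F 2]

theorem center_eq_bot : Subgroup.center SL(2, F) = ⊥ := by
  rw [eq_bot_iff]
  intro g hg
  have hu := Subgroup.mem_center_iff.mp hg (upper 1)
  have hl := Subgroup.mem_center_iff.mp hg (lower 1)
  have h10 := lower_left_eq_zero_of_commute_upper_one hu.symm
  have u01 := congrArg (fun g : SL(2, F) => g 0 1) hu
  have l00 := congrArg (fun g : SL(2, F) => g 0 0) hl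
  simp [mul_entry] at u01 l00
  have h := entry_eq_one h10 (by linear_combination -u01)
  rw [Subgroup.mem_bot, eq_upper_of_entries h10 h, l00, upper_zero]

theorem cardFactors_add_one_le_of_isCoatom_chain [Finite F] {k : ℕ} (hk : Odd k) (hk1 : k ≠ 1)
    (hF : Nat.card F = 2 ^ k)
    (ih : ∀ (E : Subfield F) (a t : ℕ), a < k → Odd a → Nat.card E = 2 ^ a →
      HasUnrefinableChain (⊤ : Subgroup SL(2, E)) t → cardFactors a + 2 ≤ t)
    {M : Subgroup SL(2, F)} (hM : IsCoatom M) {t : ℕ} (ht : HasUnrefinableChain M t) :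
    cardFactors k + 1 ≤ t := by
  have hsub := cardFactors_le_cardFactors_two_pow_sub_one hk.pos.ne'
  have hadd := cardFactors_add_one_le_cardFactors_two_pow_add_one hk
  obtain ⟨γ, h⟩ := subgroup_classification M
  set M' := conjBy γ M with hM'
  have hMM' : conjBy γ⁻¹ M' = M := by
    ext g
    rw [mem_conjBy, mem_conjBy]
    constructor <;> intro h <;> convert h using 1 <;> group
  have ht' : HasUnrefinableChain M' t :=
    .of_map (f := (MulAut.conj γ⁻¹).toMonoidHom) (MulAut.conj γ⁻¹).injective
      (by rw [← hMM'] at ht; exact ht)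
  have hmax : ∀ L : Subgroup SL(2, F), M' ≤ L → L ≠ ⊤ → M' = L := by
    have hco : IsCoatom M' := ((MulAut.conj γ).mapSubgroup.isCoatom_iff M).mpr hM
    intro L h1 h2
    exact ((hco.le_iff.mp h1).resolve_left h2).symm
  rcases h with h | ⟨x, hx, h, hx'⟩ | ⟨K, hK, h⟩ | h
  · rw [hmax _ h borel_ne_top] at ht'
    have := cardFactors_add_one_le_of_chain_borel ht'
    rw [hF] at this
    omega
  · obtain ⟨a, ha0, ha1⟩ : ∃ a : F, a ≠ 0 ∧ a ≠ 1 := by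
      by_contra! hall
      have : Nat.card F ≤ 2 := by
        rw [← Set.ncard_univ, ← Set.ncard_pair (zero_ne_one (α := F))]
        refine Set.ncard_le_ncard (fun a _ => ?_) (Set.toFinite _)
        by_cases ha : a = 0
        · exact .inl ha
        · exact .inr (hall a ha)
      have h3 : 2 ^ 2 ≤ 2 ^ k := Nat.pow_le_pow_right (by norm_num) (by have := hk.pos; omega)
      omega
    have hMx := hmax _ h (dihedralNormalizer_ne_top hx ha0 ha1)
    rw [hMx] at ht' hx'
    have hle := cardFactors_card_dihedralNormalizer_le hx ht'
    have hdvd := Subgroup.card_dvd_of_le (centralizer_le_dihedralNormalizer x)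
    by_cases hroot : ∀ z : F, z ^ 2 + z * (x 0 0 + x 1 1) + 1 ≠ 0
    · have := cardFactors_le_of_dvd hdvd Nat.card_pos.ne'
      rw [card_centralizer_of_no_root hx hroot, hF] at this
      omega
    -- A split torus has order `q - 1`, which yields only `Ω(k)` factors. The last alternative of
    -- the classification makes the normalizer strictly larger, for the missing factor.
    · have hlt : Nat.card (Subgroup.centralizer {x}) < Nat.card (dihedralNormalizer x) := by
        refine lt_of_le_of_ne (Nat.le_of_dvd Nat.card_pos hdvd) fun heq => ?_
        have := Subgroup.eq_of_le_of_card_ge (centralizer_le_dihedralNormalizer x) heq.ge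
        exact hx'.resolve_right hroot this.ge
      have := cardFactors_add_one_le_of_dvd_of_lt hdvd hlt Nat.card_pos.ne'
      push Not at hroot
      obtain ⟨z, hz⟩ := hroot
      rw [card_centralizer_of_root hx hz, hF] at this
      omega
  · obtain ⟨E, p, a, hKE, hE, hp, rfl, hEcard⟩ := exists_subfield_of_prime_index hF hK
    rw [hmax _ (fun g hg => mem_range_map_subtype.mpr fun i j => hKE (h g hg i j))
      (range_map_subtype_ne_top hE)] at ht'
    have hao := (Nat.odd_mul.mp hk).2
    have := ih E a t (by have := hao.pos; have := hp.two_le; nlinarith) hao hEcard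
      (ht'.top_of_range (map_subtype_injective E))
    rw [cardFactors_prime_mul hp hao.pos.ne']
    omega
  · have hco : IsCoatom M' := ((MulAut.conj γ).mapSubgroup.isCoatom_iff M).mpr hM
    exact absurd h hco.1

end SL2

namespace SL2

open ArithmeticFunction

theorem cardFactors_add_two_le_of_chain (k : ℕ) : ∀ {F : Type u} [Field F], Odd k →
    Nat.card F = 2 ^ k → ∀ {t : ℕ}, HasUnrefinableChain (⊤ : Subgroup SL(2, F)) t →
    cardFactors k + 2 ≤ t := by
  induction k using Nat.strong_induction_on with
  | _ k ih =>
  intro F _ hk hF t ht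
  have : Finite F := Nat.finite_of_card_ne_zero (by rw [hF]; positivity)
  let _ : Fintype F := Fintype.ofFinite F
  have : CharP F 2 := charP_of_card_eq_prime_pow (Nat.card_eq_fintype_card.symm.trans hF)
  generalize hT : (⊤ : Subgroup SL(2, F)) = T at ht
  cases ht with
  | bot => exact absurd (top_le_iff.mp (hT.le.trans bot_le)) borel_ne_top
  | @cons _ M t hM ht =>
    subst hT
    -- Over the field with two elements only length two is needed, which holds since the trivial
    -- subgroup is not maximal.
    by_cases hk1 : k = 1
    · cases ht with
      | bot => exact absurd hM not_bot_covBy_top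
      | cons _ _ => simp [hk1]
    · have := cardFactors_add_one_le_of_isCoatom_chain hk hk1 hF
        (fun E a t hak hao hE h => ih a hak hao hE h) (covBy_top_iff.mp hM) ht
      omega

theorem cardFactors_add_two_le_groupDepth {k : ℕ} (hk : Odd k) (F : Type u) [Field F]
    (hF : Nat.card F = 2 ^ k) :
    cardFactors k + 2 ≤ groupDepth (Matrix.ProjectiveSpecialLinearGroup (Fin 2) F) := by
  have : Finite F := Nat.finite_of_card_ne_zero (by rw [hF]; positivity)
  let _ : Fintype F := Fintype.ofFinite F
  have : CharP F 2 := charP_of_card_eq_prime_pow (Nat.card_eq_fintype_card.symm.trans hF)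
  refine le_groupDepth_of_forall fun t ht => cardFactors_add_two_le_of_chain k hk hF ?_
  refine HasUnrefinableChain.top_of_range
    (f := QuotientGroup.mk' (Subgroup.center SL(2, F))) ?_ ?_
  · rw [← MonoidHom.ker_eq_bot_iff, QuotientGroup.ker_mk', center_eq_bot]
  · rwa [MonoidHom.range_eq_top.mpr (QuotientGroup.mk'_surjective _)]

end SL2

theorem lt_groupDepth_of_prod {n : ℕ} {p : Fin n → ℕ} (hp : ∀ i, (p i).Prime ∧ Odd (p i))
    (F : Type u) [Field F] (hF : Nat.card F = 2 ^ ∏ i, p i) :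
    n < groupDepth (Matrix.ProjectiveSpecialLinearGroup (Fin 2) F) ∧
      ArithmeticFunction.cardFactors (∏ i, p i) + 2 ≤
        groupDepth (Matrix.ProjectiveSpecialLinearGroup (Fin 2) F) := by
  have h := SL2.cardFactors_add_two_le_groupDepth
    (Finset.prod_induction p Odd (fun _ _ => Odd.mul) odd_one fun i _ => (hp i).2) F hF
  have hn := cardFactors_prod_of_prime fun i => (hp i).1
  exact ⟨by omega, h⟩

theorem exists_injective_odd_primes (n : ℕ) :
    ∃ p : Fin n → ℕ, (∀ i, (p i).Prime ∧ Odd (p i)) ∧ Function.Injective p := by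
  -- The shift by one skips the prime `2`.
  refine ⟨fun i => Nat.nth Nat.Prime (i + 1), fun i => ?_, fun i j h => ?_⟩
  · have hp := Nat.prime_nth_prime (i + 1)
    refine ⟨hp, hp.odd_of_ne_two fun h2 => ?_⟩
    have : Nat.nth Nat.Prime 0 < Nat.nth Nat.Prime (i + 1) :=
      Nat.nth_strictMono Nat.infinite_setOfPred_prime (Nat.succ_pos i.1)
    have := (Nat.prime_nth_prime 0).two_le
    omega
  · have := Nat.nth_injective Nat.infinite_setOfPred_prime h
    exact Fin.ext (by omega)

theorem theorem3 :
    (∀ n : ℕ, ∃ q : ℕ, IsPrimePow q ∧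
      ∀ (F : Type u) [Field F], Nat.card F = q →
        n < groupDepth (Matrix.ProjectiveSpecialLinearGroup (Fin 2) F)) ∧
    (∀ (n : ℕ) (p : Fin n → ℕ), (∀ i, (p i).Prime ∧ Odd (p i)) → Function.Injective p →
      ∀ k : ℕ, k = ∏ i, p i →
        ∀ (F : Type u) [Field F], Nat.card F = 2 ^ k →
          n < groupDepth (Matrix.ProjectiveSpecialLinearGroup (Fin 2) F) ∧
          ArithmeticFunction.cardFactors k + 2 ≤
            groupDepth (Matrix.ProjectiveSpecialLinearGroup (Fin 2) F)) := by
  refine ⟨fun n => ?_, ?_⟩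
  · obtain ⟨p, hp, -⟩ := exists_injective_odd_primes n
    exact ⟨2 ^ ∏ i, p i, Nat.prime_two.isPrimePow.pow
      (Finset.prod_ne_zero_iff.mpr fun i _ => (hp i).1.ne_zero),
      fun F _ hF => (lt_groupDepth_of_prod hp F hF).1⟩
  · rintro n p hp - k rfl F _ hF
    exact lt_groupDepth_of_prod hp F hF
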